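/- **Proposition (Perturbative version of the SGA equation).** Let $d\ge 0$, let $B_n=(\mathbb R^{*d})^n\times\mathbb R^d$, let $S_0(p_1,p_2,x)=x(p_1+p_2)$ on $B_2$, and let $S_n\in C^\infty(B_2)$ be real valued for $n\ge 1$. The formal series $S_h=\sum_{n\ge0}h^nS_n$ *satisfies the SGA (Symplectic Groupoid Associativity) equation* if, for all $(p_1,p_2,p_3,x)\in B_3$, $$S_h(p_1,p_2,\bar x)+S_h(\bar p,p_3,x)-\bar x\bar p=S_h(p_2,p_3,\tilde x)+S_h(p_1,\tilde p,x)-\tilde x\tilde p$$ as formal power series in $h$, where $\bar x,\bar p,\tilde x,\tilde p\in\mathbb R[[h]]^d$ are formal series solving $$\bar x=\nabla_{p_1}S_h(\bar p,p_3,x),\quad \bar p=\nabla_xS_h(p_1,p_2,\bar x),\quad \tilde x=\nabla_{p_2}S_h(p_1,\tilde p,x),\quad \tilde p=\nabla_xS_h(p_2,p_3,\tilde x).$$ Here a smooth function is evaluated at a formal series through its Taylor expansion at the constant term. For $k\ge1$ a *bipartite tree* $t$ with $|t|=k$ vertices is a tree (a connected graph without cycles) with vertex set $V_t=\{1,\dots,k\}$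 and edge set $E_t$, together with a colouring $\omega:V_t\to\{\circ,\bullet\}$ such that adjacent vertices have different colours; $T$ is the set of all of them (as labelled trees, not up to isomorphism). For $i\in\{1,2\}$ and $f_1,\dots,f_k\in C^\infty(B_2)$ put $$C^i_t(f_1,\dots,f_k)(p_1,p_2,p_3,x)=\sum_{\beta:E_t\to\{1,\dots,d\}}\ \prod_{v\in V_t}\Big[\Big(\prod_{e\in E_t,\ v\in e}D^{i,\omega(v)}_{\beta(e)}\Big)f_v\Big],$$ where * $D^{1,\circ}_a=\partial/\partial x^a$, with the result evaluated at $(p_1,p_2,x)$; * $D^{1,\bullet}_a=\partial/\partial (p_1)_a$ (first argument), with the result evaluated at $(p_1+p_2,p_3,x)$; * $D^{2,\circ}_a=\partial/\partial x^a$, with the result evaluated at $(p_2,p_3,x)$; * $D^{2,\bullet}_a=\partial/\partial (p_2)_a$ (second argument), with the result evaluated at $(p_1,p_2+p_3,x)$. Then $S_h=S_0+\sum_{n\ge1}h^nS_n$ satisfies the SGA equation if and only if for every $n>0$, identically on $B_3$, $$\sum_{\substack{t\in T\\|t|\le n}}\frac1{|t|!}\sum_{\substack{n_1+\dots+n_{|t|}=n\\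 n_i\ge1}}\Big(C^1_t(S_{n_1},\dots,S_{n_{|t|}})-C^2_t(S_{n_1},\dots,S_{n_{|t|}})\Big)=0 .$$ -/

import Mathlib

open scoped ContDiff Matrix Nat

noncomputable section

namespace SGA

/-- The space `B₂ = (ℝ*ᵈ)² × ℝᵈ`; its point `(p₁, p₂, x)` is `![p₁, p₂, x]`, so that slot `0` is `p₁`,
slot `1` is `p₂` and slot `2` is `x`. -/
abbrev B₂ (d : ℕ) : Type := Fin 3 → Fin d → ℝ

variable {d : ℕ}

/-- The partial derivative of `f` with respect to coordinate `c.2` of slot `c.1`. -/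
def partialDeriv (c : Fin 3 × Fin d) (f : B₂ d → ℝ) : B₂ d → ℝ :=
  fun y => fderiv ℝ f y (Pi.single c.1 (Pi.single c.2 1))

/-- The iterated partial derivative of `f` along a list of coordinates. For smooth `f` it does not
depend on the order of the list. -/
def mixedPartial (l : List (Fin 3 × Fin d)) (f : B₂ d → ℝ) : B₂ d → ℝ :=
  l.foldr partialDeriv f

/-! ### Substitution of formal series -/

/-- The constant term of a point of `B₂` with coordinates in `ℝ[[h]]`. -/
def constTerm (y : Fin 3 → Fin d → PowerSeries ℝ) : B₂ d :=
  fun s i => PowerSeries.constantCoeff (y s i)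

/-- The formal series `f(y)` for a smooth `f` and a point `y = y₀ + O(h)` with coordinates in
`ℝ[[h]]`, through the Taylor expansion
`f(y) = ∑ₘ (1/m!) ∑_{β₁,…,βₘ} (∂_{β₁}⋯∂_{βₘ} f)(y₀) (y - y₀)_{β₁} ⋯ (y - y₀)_{βₘ}`.
The terms with `m > n` do not contribute to the coefficient of `hⁿ`. -/
def taylorSubst (f : B₂ d → ℝ) (y : Fin 3 → Fin d → PowerSeries ℝ) : PowerSeries ℝ :=
  PowerSeries.mk fun n => ∑ m ∈ Finset.range (n + 1), ((m ! : ℕ) : ℝ)⁻¹ *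
    ∑ β : Fin m → Fin 3 × Fin d,
      mixedPartial (List.ofFn β) f (constTerm y) *
        PowerSeries.coeff n
          (∏ j, (y (β j).1 (β j).2 - PowerSeries.C (constTerm y (β j).1 (β j).2)))

/-- The formal series `S_h(y) = ∑ₙ hⁿ Sₙ(y)`. -/
def seriesSubst (S : ℕ → B₂ d → ℝ) (y : Fin 3 → Fin d → PowerSeries ℝ) : PowerSeries ℝ :=
  PowerSeries.mk fun n => ∑ ij ∈ Finset.HasAntidiagonal.antidiagonal n,
    PowerSeries.coeff ij.2 (taylorSubst (S ij.1) y)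

/-- The gradient of `S_h` with respect to the variables of slot `s`, evaluated at the formal
point `y`. -/
def seriesGrad (s : Fin 3) (S : ℕ → B₂ d → ℝ) (y : Fin 3 → Fin d → PowerSeries ℝ) :
    Fin d → PowerSeries ℝ :=
  fun i => seriesSubst (fun n => partialDeriv (s, i) (S n)) y

/-- A vector of `ℝᵈ` as a constant vector of formal series. -/
def const (v : Fin d → ℝ) : Fin d → PowerSeries ℝ := fun i => PowerSeries.C (v i)

/-- `S_h = ∑ₙ hⁿ Sₙ` satisfies the Symplectic Groupoid Associativity equation, as an identity of
formal series in `h` at every `(p₁, p₂, p₃, x) ∈ B₃`; `xb`, `pb`, `xt`, `pt` are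
`x̄`, `p̄`, `x̃`, `p̃`. -/
def Satisfies (S : ℕ → B₂ d → ℝ) : Prop :=
  ∀ p₁ p₂ p₃ x : Fin d → ℝ, ∃ xb pb xt pt : Fin d → PowerSeries ℝ,
    xb = seriesGrad 0 S ![pb, const p₃, const x] ∧
    pb = seriesGrad 2 S ![const p₁, const p₂, xb] ∧
    xt = seriesGrad 1 S ![const p₁, pt, const x] ∧
    pt = seriesGrad 2 S ![const p₂, const p₃, xt] ∧
    seriesSubst S ![const p₁, const p₂, xb] + seriesSubst S ![pb, const p₃, const x] - xb ⬝ᵥ pb =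
      seriesSubst S ![const p₂, const p₃, xt] + seriesSubst S ![const p₁, pt, const x] - xt ⬝ᵥ pt

/-! ### Bipartite Cayley trees -/

/-- The colours `∘` and `•`. -/
inductive Colour : Type
  | white
  | black
  deriving DecidableEq

instance : Fintype Colour := ⟨{.white, .black}, fun c => by cases c <;> simp⟩

/-- The bipartite trees with vertex set `{1, …, k}`. -/
def BipartiteTree (k : ℕ) : Type :=
  {t : SimpleGraph (Fin k) × (Fin k → Colour) //
    t.1.IsTree ∧ ∀ v w, t.1.Adj v w → t.2 v ≠ t.2 w}

/-- The underlying graph of a bipartite tree. -/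
def BipartiteTree.graph {k : ℕ} (t : BipartiteTree k) : SimpleGraph (Fin k) := t.1.1

/-- The colouring `ω` of a bipartite tree. -/
def BipartiteTree.colour {k : ℕ} (t : BipartiteTree k) : Fin k → Colour := t.1.2

open Classical in
instance (k : ℕ) : Fintype (BipartiteTree k) :=
  inferInstanceAs (Fintype {t : SimpleGraph (Fin k) × (Fin k → Colour) //
    t.1.IsTree ∧ ∀ v w, t.1.Adj v w → t.2 v ≠ t.2 w})

open Classical in
instance {k : ℕ} (t : BipartiteTree k) : Fintype t.graph.edgeSet := Fintype.ofFinite _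

/-- The two sides of the equation: `first` is expressed by `x̄, p̄`, `second` by `x̃, p̃`. -/
inductive Side : Type
  | first
  | second

/-- The slot with respect to which the function at a vertex of the given colour is differentiated:
`x` at a white vertex; at a black one `p₁` on the first side and `p₂` on the second. -/
def slot : Side → Colour → Fin 3
  | _, .white => 2
  | .first, .black => 0
  | .second, .black => 1

/-- The point of `B₂` at which the function at a vertex of the given colour is evaluated. -/
def basePoint (p₁ p₂ p₃ x : Fin d → ℝ) : Side → Colour → B₂ d
  | .first, .white => ![p₁, p₂, x]
  | .first, .black => ![p₁ + p₂, p₃, x]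
  | .second, .white => ![p₂, p₃, x]
  | .second, .black => ![p₁, p₂ + p₃, x]

open Classical in
/-- The list of the edges of `t` that contain the vertex `v`, in some order. -/
def BipartiteTree.edgesAt {k : ℕ} (t : BipartiteTree k) (v : Fin k) : List t.graph.edgeSet :=
  (Finset.univ.filter fun e : t.graph.edgeSet => v ∈ (e : Sym2 (Fin k))).toList

open Classical in
/-- The multidifferential map `C^i_t(f₁, …, f_k) : B₃ → ℝ`: the sum over all labellings
`β : E_t → {1, …, d}` of the edges of the product over the vertices `v` of the derivative of `f_v`
along the labels of the edges at `v`. -/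
def C (i : Side) {k : ℕ} (t : BipartiteTree k) (f : Fin k → B₂ d → ℝ)
    (p₁ p₂ p₃ x : Fin d → ℝ) : ℝ :=
  ∑ β : t.graph.edgeSet → Fin d, ∏ v : Fin k,
    mixedPartial ((t.edgesAt v).map fun e => (slot i (t.colour v), β e)) (f v)
      (basePoint p₁ p₂ p₃ x i (t.colour v))

/-- The tuples `(n₁, …, n_k)` with `n₁ + ⋯ + n_k = n` and all `nᵢ ≥ 1`. -/
def compositions (k n : ℕ) : Finset (Fin k → ℕ) :=
  (Finset.piAntidiag Finset.univ n).filter fun ν => ∀ v, 1 ≤ ν v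

end SGA

end

/-! Each side of the SGA equation is a critical value. On the first side put `x̄ = x + ξ` and `p̄ =
p₁ + p₂ + π`. Since `S₀` is bilinear, its linear terms cancel against those of `x̄ p̄`, and the side
becomes `x (p₁ + p₂ + p₃) + W` with `W = F(ξ) + G(π) - ξ π`. Here `F` and `G` are the parts of `S_h`
of positive order in `h`, expanded at the base points of the white and the black vertices, and the
implicit equations read `π = ∇F(ξ)`, `ξ = ∇G(π)` (`implicit_iff`, `side_value`). The second side has
the same form and the same constant, so the equation says that the two values `W` agree. It remains
to expand `W` over bipartite trees (`coeff_critValue`).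

For this a parameter `s` is inserted: `W(s) = F(s ξ) + G(s π) - s ξ π` with `π = ∇F(s ξ)` and `ξ =
∇G(s π)`. By the envelope theorem (`coeffwise_critValue`) only explicit dependence is
differentiated. So the derivatives of `W` in the white and black base points are `π` and `ξ`, and
`∂W/∂s = ξ π`. Thus `W` solves the Hamilton-Jacobi equation `∂W/∂s = ∑ᵢ ∂W/∂(white i) ∂W/∂(black
i)`, with `W(0) = F + G` at the base points; this is a recursion for the coefficients of `sᵐ`
(`slice_critValue_succ`).

Sums over labelled trees obey the same recursion. A tree with `n + 1` vertices has `n` edges, and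
cutting one of them leaves two trees, each with a marked vertex, one white and one black; marking a
vertex amounts to differentiating (`card_nsmul_treeSum`). Hence the coefficient of `sᵐ` is the sum
over trees with `m + 1` vertices divided by `(m + 1)!` (`treeSum_eq_factorial_smul`).

The argument needs independent white and black base points, whereas the actual ones share
coordinates. It is therefore run over a polynomial ring in formal jet variables, then specialised to
the actual derivatives and to `s = 1`. Every vertex carries a factor `h`, so at order `hⁿ` only
trees with at most `n` vertices occur. -/

noncomputable section

namespace SGA

open PowerSeries

/-! ### Homogeneous Taylor terms over a commutative ring. -/

section Taylor

variable {ι : Type*} [Fintype ι] {A : Type*} [CommRing A]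

/-- The homogeneous part of degree `m` (without the factor `1 / m!`) of the Taylor expansion with
jets `J`, evaluated at the increment `y`. -/
def taylorTerm (y : ι → A) : ℕ → (Multiset ι → A) → A
  | 0, J => J 0
  | m + 1, J => ∑ i, y i * taylorTerm y m fun l => J (i ::ₘ l)

theorem taylorTerm_succ (y : ι → A) (m : ℕ) (J : Multiset ι → A) :
    taylorTerm y (m + 1) J = ∑ i, y i * taylorTerm y m fun l => J (i ::ₘ l) := rfl

theorem taylorTerm_add (y : ι → A) (m : ℕ) (J K : Multiset ι → A) :
    taylorTerm y m (fun l => J l + K l) = taylorTerm y m J + taylorTerm y m K := by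
  induction m generalizing J K with
  | zero => rfl
  | succ m ih => simp only [taylorTerm_succ, ih, mul_add, Finset.sum_add_distrib]

theorem taylorTerm_zero_jet (y : ι → A) (m : ℕ) : taylorTerm y m (fun _ => 0) = 0 := by
  induction m with
  | zero => rfl
  | succ m ih => simp [taylorTerm_succ, ih]

theorem map_taylorTerm {B : Type*} [CommRing B] (θ : A →+* B) (y : ι → A) (m : ℕ)
    (J : Multiset ι → A) :
    θ (taylorTerm y m J) = taylorTerm (fun i => θ (y i)) m fun l => θ (J l) := by
  induction m generalizing J with
  | zero => rfl
  | succ m ih => simp [taylorTerm_succ, ih]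

/-- The Leibniz rule gives one term for each of the `m + 1` increments. Jets are indexed by
multisets, hence symmetric, so these terms coincide and produce the factor `m + 1`. -/
theorem derivation_taylorTerm_succ [Algebra ℝ A] (D : Derivation ℝ A A) (y : ι → A) (m : ℕ)
    (J : Multiset ι → A) :
    D (taylorTerm y (m + 1) J) = taylorTerm y (m + 1) (fun l => D (J l)) +
      (m + 1 : ℝ) • ∑ i, taylorTerm y m (fun l => J (i ::ₘ l)) * D (y i) := by
  induction m generalizing J with
  | zero =>
    simp [taylorTerm, Finset.sum_add_distrib]
  | succ m ih =>
    have key : ∑ i, y i * ∑ j, taylorTerm y m (fun l => J (i ::ₘ j ::ₘ l)) * D (y j) =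
        ∑ j, taylorTerm y (m + 1) (fun l => J (j ::ₘ l)) * D (y j) := by
      simp_rw [Finset.mul_sum]
      rw [Finset.sum_comm]
      refine Finset.sum_congr rfl fun j _ => ?_
      rw [taylorTerm_succ, Finset.sum_mul]
      refine Finset.sum_congr rfl fun i _ => ?_
      simp_rw [Multiset.cons_swap i j]
      ring
    rw [taylorTerm_succ, map_sum]
    simp_rw [Derivation.leibniz, smul_eq_mul, ih, mul_add, mul_smul_comm, Finset.sum_add_distrib,
      ← Finset.smul_sum]
    rw [key, taylorTerm_succ y (m + 1) fun l => D (J l)]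
    simp_rw [mul_comm (taylorTerm y (m + 1) _) (D _)]
    push_cast
    module

theorem dvd_taylorTerm {a : A} (y : ι → A) (m : ℕ) {J : Multiset ι → A} (hJ : ∀ l, a ∣ J l) :
    a ∣ taylorTerm y m J := by
  induction m generalizing J with
  | zero => exact hJ 0
  | succ m ih => exact Finset.dvd_sum fun i _ => (ih fun l => hJ _).mul_left _

theorem pow_dvd_taylorTerm {a : A} {y : ι → A} (hy : ∀ i, a ∣ y i) (m : ℕ) (J : Multiset ι → A) :
    a ^ m ∣ taylorTerm y m J := by
  induction m generalizing J with
  | zero => simp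
  | succ m ih =>
    rw [pow_succ']
    exact Finset.dvd_sum fun i _ => mul_dvd_mul (hy i) (ih _)

/-- A Lipschitz estimate: the divisor of the jets is gained on top of that of the difference of the
increments. With both divisors powers of `X`, this makes the gradient map a contraction. -/
theorem dvd_taylorTerm_sub {a b : A} {y z : ι → A} (h : ∀ i, b ∣ y i - z i) (m : ℕ)
    {J : Multiset ι → A} (hJ : ∀ l, a ∣ J l) :
    b * a ∣ taylorTerm y m J - taylorTerm z m J := by
  induction m generalizing J with
  | zero => simp [taylorTerm]
  | succ m ih =>
    rw [taylorTerm_succ, taylorTerm_succ, ← Finset.sum_sub_distrib]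
    refine Finset.dvd_sum fun i _ => ?_
    have e : y i * taylorTerm y m (fun l => J (i ::ₘ l)) -
        z i * taylorTerm z m (fun l => J (i ::ₘ l)) =
        (y i - z i) * taylorTerm y m (fun l => J (i ::ₘ l)) +
        z i * (taylorTerm y m (fun l => J (i ::ₘ l)) - taylorTerm z m (fun l => J (i ::ₘ l))) := by
      ring
    rw [e]
    exact dvd_add (mul_dvd_mul (h i) (dvd_taylorTerm y m fun l => hJ _))
      ((ih fun l => hJ _).mul_left _)

end Taylor

theorem eq_of_forall_X_pow_dvd_sub {A : Type*} [CommRing A] {f g : A⟦X⟧} (h : ∀ n, (X : A⟦X⟧) ^ n ∣ f - g) : f = g := by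
  ext n
  have := X_pow_dvd_iff.1 (h (n + 1)) n n.lt_succ_self
  rwa [map_sub, sub_eq_zero] at this

/-! ### Formal Taylor series and their chain rule. -/

section FormalTaylor

variable {ι : Type*} [Fintype ι] {A : Type*} [CommRing A] [Algebra ℝ A]

/-- The Taylor polynomial of degree less than `N`. -/
def taylorPoly (N : ℕ) (J : Multiset ι → A) (y : ι → A) : A :=
  ∑ m ∈ Finset.range N, ((m ! : ℕ) : ℝ)⁻¹ • taylorTerm y m J

/-- The Taylor series with jets `J` at the increment `y`, as a formal series; it is meaningful for
increments without constant term. -/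
def formalTaylor (J : Multiset ι → A⟦X⟧) (y : ι → A⟦X⟧) : A⟦X⟧ :=
  PowerSeries.mk fun n => coeff n (taylorPoly (n + 1) J y)

theorem dvd_taylorPoly_sub {a b : A} {y z : ι → A} (h : ∀ i, b ∣ y i - z i) (N : ℕ)
    {J : Multiset ι → A} (hJ : ∀ l, a ∣ J l) :
    b * a ∣ taylorPoly N J y - taylorPoly N J z := by
  rw [taylorPoly, taylorPoly, ← Finset.sum_sub_distrib]
  refine Finset.dvd_sum fun m _ => ?_
  rw [← smul_sub]
  exact dvd_smul_of_dvd _ (dvd_taylorTerm_sub h m hJ)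

theorem taylorPoly_add (N : ℕ) (y : ι → A) (J K : Multiset ι → A) :
    taylorPoly N (fun l => J l + K l) y = taylorPoly N J y + taylorPoly N K y := by
  simp only [taylorPoly, taylorTerm_add, smul_add, Finset.sum_add_distrib]

theorem formalTaylor_add (y : ι → A⟦X⟧) (J K : Multiset ι → A⟦X⟧) :
    formalTaylor (fun l => J l + K l) y = formalTaylor J y + formalTaylor K y := by
  ext n
  simp only [formalTaylor, taylorPoly_add, coeff_mk, map_add]

theorem formalTaylor_zero_jet (y : ι → A⟦X⟧) : formalTaylor (fun _ => 0) y = 0 := by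
  ext n
  simp [formalTaylor, taylorPoly, taylorTerm_zero_jet]

theorem X_pow_dvd_taylorPoly_sub {y : ι → A⟦X⟧} (hy : ∀ i, X ∣ y i) {M N : ℕ} (h : N ≤ M)
    (J : Multiset ι → A⟦X⟧) : X ^ N ∣ taylorPoly M J y - taylorPoly N J y := by
  rw [taylorPoly, taylorPoly, ← Finset.sum_range_add_sum_Ico _ h, add_sub_cancel_left]
  refine Finset.dvd_sum fun m hm => dvd_smul_of_dvd _ ?_
  exact (pow_dvd_pow _ (Finset.mem_Ico.1 hm).1).trans (pow_dvd_taylorTerm hy m J)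

theorem X_pow_dvd_formalTaylor_sub {y : ι → A⟦X⟧} (hy : ∀ i, X ∣ y i) (N : ℕ)
    (J : Multiset ι → A⟦X⟧) : X ^ N ∣ formalTaylor J y - taylorPoly N J y := by
  rw [X_pow_dvd_iff]
  intro n hn
  have := X_pow_dvd_iff.1 (X_pow_dvd_taylorPoly_sub hy hn J) n n.lt_succ_self
  rw [map_sub, sub_eq_zero] at this
  rw [map_sub, this, formalTaylor, coeff_mk, sub_self]

theorem formalTaylor_congr {n : ℕ} {y z : ι → A⟦X⟧} (h : ∀ i, X ^ n ∣ y i - z i)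
    {J : Multiset ι → A⟦X⟧} (hJ : ∀ l, X ∣ J l) :
    X ^ (n + 1) ∣ formalTaylor J y - formalTaylor J z := by
  rw [X_pow_dvd_iff]
  intro k hk
  have := X_pow_dvd_iff.1 (pow_succ (X : A⟦X⟧) n ▸ dvd_taylorPoly_sub h (k + 1) hJ) k hk
  simpa [formalTaylor] using this

theorem X_dvd_formalTaylor {J : Multiset ι → A⟦X⟧} (hJ : ∀ l, X ∣ J l) (y : ι → A⟦X⟧) :
    X ∣ formalTaylor J y := by
  rw [X_dvd_iff, ← coeff_zero_eq_constantCoeff_apply, formalTaylor, coeff_mk, taylorPoly,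
    coeff_zero_eq_constantCoeff_apply, ← X_dvd_iff]
  exact Finset.dvd_sum fun m _ => dvd_smul_of_dvd _ (dvd_taylorTerm y m hJ)

theorem formalTaylor_zero (J : Multiset ι → A⟦X⟧) : formalTaylor J (fun _ => 0) = J 0 := by
  ext n
  rw [formalTaylor, coeff_mk, taylorPoly, Finset.sum_range_succ']
  simp [taylorTerm]

theorem map_taylorPoly {B : Type*} [CommRing B] [Algebra ℝ B] (θ : A →ₐ[ℝ] B) (N : ℕ)
    (J : Multiset ι → A) (y : ι → A) :
    θ (taylorPoly N J y) = taylorPoly N (fun l => θ (J l)) fun i => θ (y i) := by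
  simp only [taylorPoly, map_sum, map_smul]
  refine Finset.sum_congr rfl fun m _ => ?_
  congr 1
  exact map_taylorTerm θ.toRingHom y m J

theorem map_formalTaylor {B : Type*} [CommRing B] [Algebra ℝ B] (θ : A →ₐ[ℝ] B)
    (J : Multiset ι → A⟦X⟧) (y : ι → A⟦X⟧) :
    PowerSeries.mapAlgHom θ (formalTaylor J y) =
      formalTaylor (fun l => PowerSeries.mapAlgHom θ (J l)) fun i =>
        PowerSeries.mapAlgHom θ (y i) := by
  ext n
  simp only [formalTaylor, ← map_taylorPoly]
  simp [PowerSeries.mapAlgHom_apply]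

/-- The coefficientwise extension of a derivation to formal power series. -/
def coeffwise (D : Derivation ℝ A A) : Derivation ℝ A⟦X⟧ A⟦X⟧ :=
  Derivation.mk'
    { toFun := fun f => PowerSeries.mk fun n => D (coeff n f)
      map_add' := fun f g => by ext n; simp
      map_smul' := fun r f => by ext n; simp }
    fun f g => by
      ext n
      simp only [LinearMap.coe_mk, AddHom.coe_mk, coeff_mk, coeff_mul, map_sum, Derivation.leibniz,
        smul_eq_mul, Finset.sum_add_distrib, map_add]
      congr 1
      rw [← Finset.Nat.sum_antidiagonal_swap]
      simp

@[simp]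
theorem coeff_coeffwise (D : Derivation ℝ A A) (n : ℕ) (f : A⟦X⟧) :
    coeff n (coeffwise D f) = D (coeff n f) := by
  simp [coeffwise]

theorem X_pow_dvd_coeffwise (D : Derivation ℝ A A) {n : ℕ} {f : A⟦X⟧} (h : X ^ n ∣ f) :
    X ^ n ∣ coeffwise D f := by
  rw [X_pow_dvd_iff] at h ⊢
  intro m hm
  rw [coeff_coeffwise, h m hm, map_zero]

/-- Differentiating the increment lowers the degree by one, which explains the two truncation
orders; the factor `m + 1` turns `1 / (m + 1)!` into `1 / m!`. -/
theorem derivation_taylorPoly_succ (D : Derivation ℝ A A) (y : ι → A) (N : ℕ)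
    (J : Multiset ι → A) :
    D (taylorPoly (N + 1) J y) = taylorPoly (N + 1) (fun l => D (J l)) y +
      ∑ i, taylorPoly N (fun l => J (i ::ₘ l)) y * D (y i) := by
  simp only [taylorPoly, Finset.sum_range_succ', map_add, map_sum, Derivation.map_smul,
    derivation_taylorTerm_succ, smul_add, Finset.sum_add_distrib, Finset.sum_mul]
  rw [Finset.sum_comm (s := Finset.univ), add_right_comm]
  congr 1
  refine Finset.sum_congr rfl fun m _ => ?_
  rw [smul_smul, Finset.smul_sum]
  refine Finset.sum_congr rfl fun i _ => ?_
  rw [smul_mul_assoc]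
  congr 1
  have h1 : (m ! : ℝ) ≠ 0 := by positivity
  have h2 : (m : ℝ) + 1 ≠ 0 := by positivity
  rw [Nat.factorial_succ]
  push_cast
  field_simp

/-- The chain rule for formal Taylor series. -/
theorem coeffwise_formalTaylor (D : Derivation ℝ A A) {y : ι → A⟦X⟧} (hy : ∀ i, X ∣ y i)
    (J : Multiset ι → A⟦X⟧) :
    coeffwise D (formalTaylor J y) = formalTaylor (fun l => coeffwise D (J l)) y +
      ∑ i, formalTaylor (fun l => J (i ::ₘ l)) y * coeffwise D (y i) := by
  -- Modulo `X ^ N` every series may be replaced by a Taylor polynomial, and the identity becomes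
  -- the one for polynomials.
  refine eq_of_forall_X_pow_dvd_sub fun N => ?_
  have h1 := X_pow_dvd_coeffwise D
    ((pow_dvd_pow X N.le_succ).trans (X_pow_dvd_formalTaylor_sub hy (N + 1) J))
  have h2 := (pow_dvd_pow X N.le_succ).trans
    (X_pow_dvd_formalTaylor_sub hy (N + 1) fun l => coeffwise D (J l))
  have h3 : X ^ N ∣ ∑ i, (formalTaylor (fun l => J (i ::ₘ l)) y -
      taylorPoly N (fun l => J (i ::ₘ l)) y) * coeffwise D (y i) :=
    Finset.dvd_sum fun i _ => (X_pow_dvd_formalTaylor_sub hy N _).mul_right _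
  rw [map_sub, derivation_taylorPoly_succ] at h1
  simp only [sub_mul, Finset.sum_sub_distrib] at h3
  convert dvd_sub (dvd_sub h1 h2) h3 using 1
  ring

end FormalTaylor

/-! ### The contraction principle for the `X`-adic topology. -/

section FixedPoint

variable {κ : Type*} {A : Type*} [CommRing A]

/-- The iterates from `0` stabilise coefficient by coefficient: the `n`-th iterate is correct modulo
`X ^ n`, both for the limit and for any other fixed point. -/
theorem existsUnique_fixedPoint (Φ : (κ → A⟦X⟧) → κ → A⟦X⟧)
    (hΦ : ∀ n y z, (∀ k, X ^ n ∣ y k - z k) → ∀ k, X ^ (n + 1) ∣ Φ y k - Φ z k) :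
    ∃! y, y = Φ y := by
  have step : ∀ n k, X ^ n ∣ Φ^[n + 1] 0 k - Φ^[n] 0 k := by
    intro n
    induction n with
    | zero => simp
    | succ n ih =>
      rw [Function.iterate_succ_apply' Φ (n + 1), Function.iterate_succ_apply' Φ n]
      refine hΦ n _ _ fun k => ?_
      rw [← Function.iterate_succ_apply' Φ n]
      exact ih k
  have steps : ∀ n m k, n ≤ m → X ^ n ∣ Φ^[m] 0 k - Φ^[n] 0 k := by
    intro n m k h
    induction m, h using Nat.le_induction with
    | base => simp
    | succ m hm ih =>
      rw [← sub_add_sub_cancel _ (Φ^[m] 0 k)]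
      exact dvd_add ((pow_dvd_pow X hm).trans (step m k)) ih
  -- The coefficient of `X ^ n` no longer changes from the iterate `n + 1` on.
  let y : κ → A⟦X⟧ := fun k => PowerSeries.mk fun n => coeff n (Φ^[n + 1] 0 k)
  have hy : ∀ n k, X ^ n ∣ y k - Φ^[n] 0 k := by
    intro n k
    rw [X_pow_dvd_iff]
    intro m hm
    have := X_pow_dvd_iff.1 (steps (m + 1) n k hm) m m.lt_succ_self
    rw [map_sub, sub_eq_zero] at this
    rw [map_sub, this]
    simp [y]
  refine ⟨y, ?_, fun z hz => ?_⟩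
  · funext k
    refine eq_of_forall_X_pow_dvd_sub fun n => ?_
    have h1 := hΦ n y _ (hy n) k
    rw [← Function.iterate_succ_apply' Φ n] at h1
    have h2 := dvd_sub (hy (n + 1) k) h1
    rw [sub_sub_sub_cancel_right] at h2
    exact (pow_dvd_pow X n.le_succ).trans h2
  · funext k
    refine eq_of_forall_X_pow_dvd_sub fun n => ?_
    have : ∀ n k, X ^ n ∣ z k - Φ^[n] 0 k := by
      intro n
      induction n with
      | zero => simp
      | succ n ih =>
        intro k
        rw [Function.iterate_succ_apply' Φ n]
        conv_rhs => rw [hz]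
        exact hΦ n _ _ ih k
    have h2 := dvd_sub (this n k) (hy n k)
    rwa [sub_sub_sub_cancel_right] at h2

end FixedPoint

/-- The colour different from a given one. -/
def Colour.other : Colour → Colour
  | .white => .black
  | .black => .white

theorem Colour.sum_eq {M : Type*} [AddCommMonoid M] (f : Colour → M) :
    ∑ c, f c = f .white + f .black := by
  have h : (Finset.univ : Finset Colour) = {.white, .black} := rfl
  rw [h, Finset.sum_pair (by decide)]

/-! ### The critical-point system and the envelope theorem. -/

section CriticalValue

variable {ι : Type*} [Fintype ι] {A : Type*} [CommRing A] [Algebra ℝ A]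

/-- The right-hand side of the system `π = ∇F(s ξ)`, `ξ = ∇G(s π)`, where `J .white` and `J .black`
are the jets of `F` and `G`; the unknowns are `π = y (.white, ·)` and `ξ = y (.black, ·)`. -/
def gradMap (J : Colour → Multiset ι → A⟦X⟧) (s : A⟦X⟧) (y : Colour × ι → A⟦X⟧) :
    Colour × ι → A⟦X⟧ :=
  fun k => formalTaylor (fun l => J k.1 (k.2 ::ₘ l)) fun i => s * y (k.1.other, i)

/-- The value `F(s ξ) + G(s π) - s ξ π`. -/
def critValue (J : Colour → Multiset ι → A⟦X⟧) (s : A⟦X⟧) (y : Colour × ι → A⟦X⟧) : A⟦X⟧ :=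
  ∑ c, formalTaylor (J c) (fun i => s * y (c.other, i)) -
    s * ∑ i, y (.white, i) * y (.black, i)

theorem existsUnique_gradMap {J : Colour → Multiset ι → A⟦X⟧} (hJ : ∀ c l, X ∣ J c l)
    (s : A⟦X⟧) : ∃! y, y = gradMap J s y :=
  existsUnique_fixedPoint _ fun n y z h k =>
    formalTaylor_congr (fun i => by rw [← mul_sub]; exact (h _).mul_left _) fun l => hJ _ _

theorem X_dvd_of_eq_gradMap {J : Colour → Multiset ι → A⟦X⟧} (hJ : ∀ c l, X ∣ J c l)
    {s : A⟦X⟧} {y : Colour × ι → A⟦X⟧} (hy : y = gradMap J s y) (k : Colour × ι) : X ∣ y k := by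
  rw [hy]
  exact X_dvd_formalTaylor (fun l => hJ _ _) _

/-- The envelope theorem: the derivative of the critical value only sees the explicit
dependence. -/
theorem coeffwise_critValue {J : Colour → Multiset ι → A⟦X⟧} (hJ : ∀ c l, X ∣ J c l)
    {s : A⟦X⟧} {y : Colour × ι → A⟦X⟧} (hy : y = gradMap J s y) (D : Derivation ℝ A A) :
    coeffwise D (critValue J s y) =
      ∑ c, formalTaylor (fun l => coeffwise D (J c l)) (fun i => s * y (c.other, i)) +
        coeffwise D s * ∑ i, y (.white, i) * y (.black, i) := by
  have hX : ∀ c i, X ∣ s * y (c, i) := fun c i => (X_dvd_of_eq_gradMap hJ hy _).mul_left _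
  -- The critical equations replace each gradient by an unknown; the derivatives of the unknowns
  -- then cancel against those coming from the product term.
  have hw : ∀ c i, formalTaylor (fun l => J c (i ::ₘ l)) (fun i => s * y (c.other, i)) =
      y (c, i) := fun c i => (congr_fun hy (c, i)).symm
  rw [critValue, map_sub, map_sum]
  have e1 : ∀ a b : ι → A⟦X⟧, ∑ i, a i * (s * b i) = s * ∑ i, a i * b i := fun a b => by
    rw [Finset.mul_sum]
    exact Finset.sum_congr rfl fun i _ => mul_left_comm _ _ _
  have e2 : ∀ a b : ι → A⟦X⟧, ∑ i, a i * (b i * coeffwise D s) =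
      coeffwise D s * ∑ i, a i * b i := fun a b => by
    rw [Finset.mul_sum]
    exact Finset.sum_congr rfl fun i _ => by ring
  simp_rw [coeffwise_formalTaylor D (hX _), hw, Colour.sum_eq, Colour.other, Derivation.leibniz,
    smul_eq_mul, map_sum, Derivation.leibniz, smul_eq_mul, mul_add, Finset.sum_add_distrib, e1, e2,
    mul_comm (y (.black, _)) (y (.white, _))]
  ring

theorem map_critValue {B : Type*} [CommRing B] [Algebra ℝ B] (θ : A →ₐ[ℝ] B)
    (J : Colour → Multiset ι → A⟦X⟧) (s : A⟦X⟧) (y : Colour × ι → A⟦X⟧) :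
    mapAlgHom θ (critValue J s y) =
      critValue (fun c l => mapAlgHom θ (J c l)) (mapAlgHom θ s) fun k => mapAlgHom θ (y k) := by
  simp only [critValue, map_sub, map_sum, map_mul, map_formalTaylor]

theorem map_gradMap {B : Type*} [CommRing B] [Algebra ℝ B] (θ : A →ₐ[ℝ] B)
    (J : Colour → Multiset ι → A⟦X⟧) (s : A⟦X⟧) (y : Colour × ι → A⟦X⟧) :
    (fun k => mapAlgHom θ (gradMap J s y k)) =
      gradMap (fun c l => mapAlgHom θ (J c l)) (mapAlgHom θ s) fun k => mapAlgHom θ (y k) := by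
  funext k
  simp only [gradMap, map_formalTaylor, map_mul]

end CriticalValue

/-! ### Expansion in powers of the parameter `s`. -/

section Slices

variable {A : Type*} [CommRing A] [Algebra ℝ A]

/-- The coefficientwise extension of a derivation to polynomials. -/
def polyCoeffwise (D : Derivation ℝ A A) : Derivation ℝ (Polynomial A) (Polynomial A) :=
  PolynomialModule.equivPolynomialSelf.toLinearMap.compDer D.mapCoeffs

@[simp]
theorem coeff_polyCoeffwise (D : Derivation ℝ A A) (p : Polynomial A) (n : ℕ) :
    (polyCoeffwise D p).coeff n = D (p.coeff n) := rfl

/-- The coefficients of `sᵐ`, for formal series with coefficients polynomial in `s`. -/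
def slice (m : ℕ) (f : (Polynomial A)⟦X⟧) : A⟦X⟧ :=
  PowerSeries.mk fun n => (coeff n f).coeff m

omit [Algebra ℝ A] in
theorem slice_sum {κ : Type*} (t : Finset κ) (m : ℕ) (f : κ → (Polynomial A)⟦X⟧) :
    slice m (∑ i ∈ t, f i) = ∑ i ∈ t, slice m (f i) := by
  ext n
  simp [slice]

omit [Algebra ℝ A] in
theorem slice_mul (m : ℕ) (f g : (Polynomial A)⟦X⟧) :
    slice m (f * g) = ∑ ij ∈ Finset.HasAntidiagonal.antidiagonal m, slice ij.1 f * slice ij.2 g := by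
  ext n
  simp only [slice, coeff_mk, coeff_mul, Polynomial.finsetSum_coeff, Polynomial.coeff_mul, map_sum]
  rw [Finset.sum_comm]

theorem slice_coeffwise (D : Derivation ℝ A A) (m : ℕ) (f : (Polynomial A)⟦X⟧) :
    slice m (coeffwise (polyCoeffwise D) f) = coeffwise D (slice m f) := by
  ext n
  simp [slice]

/-- The derivative with respect to the polynomial variable. -/
def polyDerivative : Derivation ℝ (Polynomial A) (Polynomial A) :=
  Polynomial.derivative'.restrictScalars ℝ

theorem polyDerivative_apply (p : Polynomial A) :
    polyDerivative p = Polynomial.derivative p := rfl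

theorem slice_derivative (m : ℕ) (f : (Polynomial A)⟦X⟧) :
    slice m (coeffwise polyDerivative f) = (m + 1 : ℝ) • slice (m + 1) f := by
  ext n
  rw [coeff_smul, slice, slice, coeff_mk, coeff_mk, coeff_coeffwise, polyDerivative_apply,
    Polynomial.coeff_derivative, Algebra.smul_def, mul_comm]
  simp

/-- Constant polynomials as an algebra homomorphism over the reals. -/
def polyC : A →ₐ[ℝ] Polynomial A := Polynomial.CAlgHom

theorem polyC_apply (a : A) : polyC a = Polynomial.C a := rfl

/-- Evaluation of the polynomial variable at `0`. -/
def evalZero : Polynomial A →ₐ[ℝ] A := (Polynomial.aeval (0 : A)).restrictScalars ℝ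

theorem slice_zero (f : (Polynomial A)⟦X⟧) : slice 0 f = mapAlgHom evalZero f := by
  ext n
  simp [slice, mapAlgHom_apply, evalZero, Polynomial.coeff_zero_eq_aeval_zero]

end Slices

/-! ### The Hamilton-Jacobi equation of the critical value. -/

section HamiltonJacobi

variable {ι : Type*} [Fintype ι] {A : Type*} [CommRing A] [Algebra ℝ A]

/-- The polynomial variable `s` as a constant formal series. -/
def scale : (Polynomial A)⟦X⟧ := PowerSeries.C Polynomial.X

/-- The jets `J` as constants with respect to the polynomial variable `s`. -/
def polyJet (J : Colour → Multiset ι → A⟦X⟧) (c : Colour) (l : Multiset ι) : (Polynomial A)⟦X⟧ :=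
  mapAlgHom polyC (J c l)

omit [Fintype ι] in
theorem X_dvd_polyJet {J : Colour → Multiset ι → A⟦X⟧} (hJ : ∀ c l, X ∣ J c l) (c : Colour)
    (l : Multiset ι) : X ∣ polyJet J c l := by
  have := hJ c l
  rw [X_dvd_iff] at this ⊢
  rw [polyJet, mapAlgHom_apply, ← coeff_zero_eq_constantCoeff_apply, coeff_map,
    coeff_zero_eq_constantCoeff_apply, this, map_zero]

variable {J : Colour → Multiset ι → A⟦X⟧} {D : Colour → ι → Derivation ℝ A A}
  {y : Colour × ι → (Polynomial A)⟦X⟧}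

/-- By the envelope theorem the derivative falls on the jets alone. By `hD` it gives the jets of the
gradient for colour `c` and `0` for the other colour, and the critical equation identifies the
result. -/
theorem coeffwise_critValue_polyJet (hJ : ∀ c l, X ∣ J c l)
    (hD : ∀ c i c' l, coeffwise (D c i) (J c' l) = if c = c' then J c' (i ::ₘ l) else 0)
    (hy : y = gradMap (polyJet J) scale y) (c : Colour) (i : ι) :
    coeffwise (polyCoeffwise (D c i)) (critValue (polyJet J) scale y) = y (c, i) := by
  have h1 : coeffwise (polyCoeffwise (D c i)) scale = 0 := by
    ext n m
    rw [coeff_coeffwise, coeff_polyCoeffwise, scale, coeff_C]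
    split_ifs
    · rw [Polynomial.coeff_X]
      split_ifs <;> simp
    · simp
  have h2 : ∀ c' l, coeffwise (polyCoeffwise (D c i)) (polyJet J c' l) =
      if c = c' then polyJet J c' (i ::ₘ l) else 0 := by
    intro c' l
    have := hD c i c' l
    ext n m
    have h3 := congr_arg (coeff n) this
    rw [coeff_coeffwise] at h3
    rw [coeff_coeffwise, coeff_polyCoeffwise, polyJet, polyJet, mapAlgHom_apply, mapAlgHom_apply,
      coeff_map]
    change D c i ((Polynomial.C (coeff n (J c' l))).coeff m) = _
    rw [Polynomial.coeff_C, apply_ite (D c i), h3]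
    split_ifs with hm hc <;> simp [polyC_apply, Polynomial.coeff_C, hm]
  rw [coeffwise_critValue (X_dvd_polyJet hJ) hy, h1, zero_mul, add_zero]
  simp_rw [h2]
  conv_rhs => rw [hy]
  cases c <;>
    simp [Colour.sum_eq, gradMap, formalTaylor_zero_jet]

/-- The coefficient of `sᵐ` in the Hamilton-Jacobi equation: the explicit dependence on `s` gives
the product of the two unknowns, which are themselves derivatives of the critical value. -/
theorem slice_critValue_succ (hJ : ∀ c l, X ∣ J c l)
    (hD : ∀ c i c' l, coeffwise (D c i) (J c' l) = if c = c' then J c' (i ::ₘ l) else 0)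
    (hy : y = gradMap (polyJet J) scale y) (m : ℕ) :
    (m + 1 : ℝ) • slice (m + 1) (critValue (polyJet J) scale y) =
      ∑ ab ∈ Finset.HasAntidiagonal.antidiagonal m, ∑ i,
        coeffwise (D .white i) (slice ab.1 (critValue (polyJet J) scale y)) *
        coeffwise (D .black i) (slice ab.2 (critValue (polyJet J) scale y)) := by
  have h1 : coeffwise polyDerivative (scale : (Polynomial A)⟦X⟧) = 1 := by
    ext n m
    rw [coeff_coeffwise, scale, coeff_C, coeff_one]
    split_ifs <;> simp [polyDerivative_apply]
  have h2 : ∀ c l, coeffwise polyDerivative (polyJet J c l) = 0 := by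
    intro c l
    ext n m
    rw [coeff_coeffwise, polyJet, mapAlgHom_apply, coeff_map]
    simp [polyDerivative_apply, polyC]
  rw [← slice_derivative, coeffwise_critValue (X_dvd_polyJet hJ) hy, h1]
  simp_rw [h2, formalTaylor_zero_jet, ← slice_coeffwise, coeffwise_critValue_polyJet hJ hD hy]
  rw [Finset.sum_const_zero, zero_add, one_mul, slice_sum, Finset.sum_comm]
  simp_rw [slice_mul]

theorem slice_critValue_zero (y : Colour × ι → (Polynomial A)⟦X⟧) :
    slice 0 (critValue (polyJet J) scale y) = J .white 0 + J .black 0 := by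
  have h1 : mapAlgHom evalZero (scale : (Polynomial A)⟦X⟧) = 0 := by
    ext n
    rw [mapAlgHom_apply, scale, coeff_map, coeff_C]
    split_ifs <;> simp [evalZero]
  have h2 : ∀ c l, mapAlgHom evalZero (polyJet J c l) = J c l := by
    intro c l
    ext n
    rw [polyJet, mapAlgHom_apply, mapAlgHom_apply, coeff_map, coeff_map]
    simp [evalZero, polyC]
  rw [slice_zero, map_critValue, critValue, h1, zero_mul, sub_zero]
  simp_rw [zero_mul, formalTaylor_zero, h2]
  rw [Colour.sum_eq]

end HamiltonJacobi

/-! ### Cutting a tree at an edge and joining two trees by an edge. -/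

section TreeOn

variable {V : Type*}

theorem reachable_induction {G : SimpleGraph V} {a v : V} (h : G.Reachable a v) {P : V → Prop}
    (h0 : P a) (hs : ∀ u w, P u → G.Adj u w → P w) : P v := by
  rw [SimpleGraph.reachable_iff_reflTransGen] at h
  induction h with
  | refl => exact h0
  | tail _ h ih => exact hs _ _ ih h

/-- The edges of `G` form a tree with vertex set `A`. -/
structure IsTreeOn (G : SimpleGraph V) (A : Finset V) : Prop where
  nonempty : A.Nonempty
  mem : ∀ v w, G.Adj v w → v ∈ A
  reachable : ∀ v ∈ A, ∀ w ∈ A, G.Reachable v w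
  bridge : ∀ v w, G.Adj v w → ¬(G.deleteEdges {s(v, w)}).Reachable v w

theorem isTreeOn_univ [Fintype V] (G : SimpleGraph V) : IsTreeOn G Finset.univ ↔ G.IsTree := by
  rw [SimpleGraph.isTree_iff, SimpleGraph.connected_iff, SimpleGraph.isAcyclic_iff_forall_adj_isBridge]
  constructor
  · intro h
    refine ⟨⟨fun v w => h.reachable v (by simp) w (by simp), ?_⟩, fun v w hvw => ?_⟩
    · exact h.nonempty.elim fun v _ => ⟨v⟩
    · rw [SimpleGraph.isBridge_iff]
      exact h.bridge v w hvw
  · rintro ⟨⟨h1, ⟨v⟩⟩, h2⟩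
    refine ⟨⟨v, by simp⟩, by simp, fun v _ w _ => h1 v w, fun v w hvw => ?_⟩
    have := h2 hvw
    rw [SimpleGraph.isBridge_iff] at this
    exact this

/-- Vertices outside `A` are isolated, so the induced graph on `A` is a genuine tree with the same
edges. -/
theorem IsTreeOn.card_edgeFinset [Fintype V] {G : SimpleGraph V} [DecidableRel G.Adj]
    {A : Finset V} (h : IsTreeOn G A) : G.edgeFinset.card + 1 = A.card := by
  classical
  have hs : G.support ⊆ (A : Set V) := fun v ⟨w, hw⟩ => h.mem v w hw
  have hA : ∀ v : (A : Set V), ∀ w, G.Reachable v w → ∃ hw : w ∈ (A : Set V),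
      (G.induce (A : Set V)).Reachable v ⟨w, hw⟩ := fun v w hw =>
    reachable_induction
      (P := fun w => ∃ hw : w ∈ (A : Set V), (G.induce (A : Set V)).Reachable v ⟨w, hw⟩) hw
      ⟨v.2, SimpleGraph.Reachable.refl _⟩ fun u w ⟨hu, hr⟩ huw =>
        ⟨h.mem w u huw.symm, hr.trans (SimpleGraph.Adj.reachable (by simpa using huw))⟩
  have ht : (G.induce (A : Set V)).IsTree := by
    rw [SimpleGraph.isTree_iff, SimpleGraph.connected_iff]
    refine ⟨⟨fun v w => (hA v w (h.reachable v v.2 w w.2)).2, ?_⟩, ?_⟩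
    · exact h.nonempty.elim fun v hv => ⟨⟨v, hv⟩⟩
    · refine SimpleGraph.IsAcyclic.induce ?_ _
      rw [SimpleGraph.isAcyclic_iff_forall_adj_isBridge]
      intro v w hvw
      rw [SimpleGraph.isBridge_iff]
      exact h.bridge v w hvw
  have e := SimpleGraph.card_edgeFinset_induce_of_support_subset hs
  have hc := ht.card_edgeFinset
  rw [← Nat.card_eq_fintype_card, Nat.card_coe_set_eq, Set.ncard_coe_finset] at hc
  rw [← e, ← hc]
  congr!

/-- The part of `A` on the side of `a` after the deletion of the edge `s(a, b)`. -/
def cutSide (G : SimpleGraph V) (A : Finset V) (a b : V) : Finset V :=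
  open Classical in A.filter fun v => (G.deleteEdges {s(a, b)}).Reachable a v

theorem mem_cutSide {G : SimpleGraph V} {A : Finset V} {a b v : V} :
    v ∈ cutSide G A a b ↔ v ∈ A ∧ (G.deleteEdges {s(a, b)}).Reachable a v := by
  simp [cutSide]

theorem IsTreeOn.mem_right {G : SimpleGraph V} {A : Finset V} (h : IsTreeOn G A) {a b : V}
    (hab : G.Adj a b) : b ∈ A := h.mem b a hab.symm

theorem IsTreeOn.left_mem_cutSide {G : SimpleGraph V} {A : Finset V} (h : IsTreeOn G A) {a b : V}
    (hab : G.Adj a b) : a ∈ cutSide G A a b :=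
  mem_cutSide.2 ⟨h.mem a b hab, SimpleGraph.Reachable.refl _⟩

theorem IsTreeOn.right_notMem_cutSide {G : SimpleGraph V} {A : Finset V} (h : IsTreeOn G A)
    {a b : V} (hab : G.Adj a b) : b ∉ cutSide G A a b :=
  fun hb => h.bridge a b hab (mem_cutSide.1 hb).2

theorem IsTreeOn.cutSide_iff {G : SimpleGraph V} {A : Finset V} (h : IsTreeOn G A) {a b : V}
    {v w : V} (hvw : (G.deleteEdges {s(a, b)}).Adj v w) :
    v ∈ cutSide G A a b ↔ w ∈ cutSide G A a b := by
  have hG : G.Adj v w := (SimpleGraph.deleteEdges_adj.1 hvw).1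
  rw [mem_cutSide, mem_cutSide]
  exact ⟨fun hv => ⟨h.mem_right hG, hv.2.trans hvw.reachable⟩,
    fun hw => ⟨h.mem v w hG, hw.2.trans hvw.symm.reachable⟩⟩

theorem IsTreeOn.of_le {G H : SimpleGraph V} {A B : Finset V} (h : IsTreeOn G A) (hle : H ≤ G)
    {r : V} (hr : r ∈ B) (hmem : ∀ v w, H.Adj v w → v ∈ B)
    (hreach : ∀ v ∈ B, H.Reachable r v) : IsTreeOn H B where
  nonempty := ⟨r, hr⟩
  mem := hmem
  reachable v hv w hw := (hreach v hv).symm.trans (hreach w hw)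
  bridge v w hvw hr' := h.bridge v w (hle hvw)
    (hr'.mono (SimpleGraph.deleteEdges_mono hle))

theorem IsTreeOn.cut_left {G H : SimpleGraph V} {A : Finset V} (h : IsTreeOn G A) {a b : V}
    (hab : G.Adj a b)
    (hH : ∀ v w, H.Adj v w ↔ G.Adj v w ∧ v ∈ cutSide G A a b ∧ w ∈ cutSide G A a b) :
    IsTreeOn H (cutSide G A a b) := by
  refine h.of_le (fun v w hvw => ((hH v w).1 hvw).1) (h.left_mem_cutSide hab)
    (fun v w hvw => ((hH v w).1 hvw).2.1) fun v hv => ?_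
  refine (reachable_induction (P := fun v => v ∈ cutSide G A a b ∧ H.Reachable a v)
    (mem_cutSide.1 hv).2 ⟨h.left_mem_cutSide hab, SimpleGraph.Reachable.refl _⟩
    fun u w ⟨hu, hr⟩ huw => ?_).2
  have hw := (h.cutSide_iff huw).1 hu
  exact ⟨hw, hr.trans
    ((hH u w).2 ⟨(SimpleGraph.deleteEdges_adj.1 huw).1, hu, hw⟩).reachable⟩

variable [DecidableEq V]

theorem IsTreeOn.cut_right {G H : SimpleGraph V} {A : Finset V} (h : IsTreeOn G A) {a b : V}
    (hab : G.Adj a b)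
    (hH : ∀ v w, H.Adj v w ↔ G.Adj v w ∧ v ∈ A \ cutSide G A a b ∧ w ∈ A \ cutSide G A a b) :
    IsTreeOn H (A \ cutSide G A a b) := by
  have hb : b ∈ A \ cutSide G A a b :=
    Finset.mem_sdiff.2 ⟨h.mem_right hab, h.right_notMem_cutSide hab⟩
  refine h.of_le (fun v w hvw => ((hH v w).1 hvw).1) hb
    (fun v w hvw => ((hH v w).1 hvw).2.1) fun v hv => ?_
  obtain ⟨hvA, hv⟩ := Finset.mem_sdiff.1 hv
  -- Following a walk from `a` in `G`, each passage through the deleted edge restarts the walk at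
  -- `a` or at `b`.
  have h1 : (G.deleteEdges {s(a, b)}).Reachable a v ∨ (G.deleteEdges {s(a, b)}).Reachable b v := by
    refine reachable_induction (P := fun v => (G.deleteEdges {s(a, b)}).Reachable a v ∨
      (G.deleteEdges {s(a, b)}).Reachable b v) (h.reachable a (h.mem a b hab) v hvA)
      (Or.inl (SimpleGraph.Reachable.refl _)) fun u w hu huw => ?_
    by_cases he : s(u, w) = s(a, b)
    · rcases Sym2.eq_iff.1 he with ⟨_, rfl⟩ | ⟨_, rfl⟩
      · exact Or.inr (SimpleGraph.Reachable.refl _)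
      · exact Or.inl (SimpleGraph.Reachable.refl _)
    · have hd : (G.deleteEdges {s(a, b)}).Adj u w := SimpleGraph.deleteEdges_adj.2 ⟨huw, he⟩
      exact hu.imp (fun h => h.trans hd.reachable) fun h => h.trans hd.reachable
  have h2 := h1.resolve_left fun h3 => hv (mem_cutSide.2 ⟨hvA, h3⟩)
  refine (reachable_induction (P := fun v => v ∈ A \ cutSide G A a b ∧ H.Reachable b v)
    h2 ⟨hb, SimpleGraph.Reachable.refl _⟩ fun u w ⟨hu, hr⟩ huw => ?_).2
  have hG : G.Adj u w := (SimpleGraph.deleteEdges_adj.1 huw).1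
  have hw : w ∈ A \ cutSide G A a b :=
    Finset.mem_sdiff.2 ⟨h.mem_right hG, fun hw =>
      (Finset.mem_sdiff.1 hu).2 ((h.cutSide_iff huw).2 hw)⟩
  exact ⟨hw, hr.trans ((hH u w).2 ⟨hG, hu, hw⟩).reachable⟩

theorem IsTreeOn.adj_cases {G : SimpleGraph V} {A : Finset V} (h : IsTreeOn G A) {a b v w : V}
    (hvw : G.Adj v w) :
    (v ∈ cutSide G A a b ∧ w ∈ cutSide G A a b) ∨
      (v ∈ A \ cutSide G A a b ∧ w ∈ A \ cutSide G A a b) ∨ s(v, w) = s(a, b) := by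
  by_cases he : s(v, w) = s(a, b)
  · exact Or.inr (Or.inr he)
  · have hd : (G.deleteEdges {s(a, b)}).Adj v w := SimpleGraph.deleteEdges_adj.2 ⟨hvw, he⟩
    have h1 := h.cutSide_iff hd
    by_cases hv : v ∈ cutSide G A a b
    · exact Or.inl ⟨hv, h1.1 hv⟩
    · exact Or.inr (Or.inl ⟨Finset.mem_sdiff.2 ⟨h.mem _ _ hvw, hv⟩,
        Finset.mem_sdiff.2 ⟨h.mem_right hvw, fun hw => hv (h1.2 hw)⟩⟩)

section Join

variable {G H₁ H₂ : SimpleGraph V} {A₁ A₂ : Finset V} {a b : V}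

theorem not_reachable_of_join (h₁ : IsTreeOn H₁ A₁) (h₂ : IsTreeOn H₂ A₂) (hd : Disjoint A₁ A₂)
    (hb : b ∈ A₂) (ha : a ∈ A₁)
    (hG : ∀ v w, G.Adj v w → H₁.Adj v w ∨ H₂.Adj v w ∨ s(v, w) = s(a, b)) {v w : V}
    (hvw : H₁.Adj v w) : ¬(G.deleteEdges {s(v, w)}).Reachable v w := by
  intro hr
  have hv := h₁.mem _ _ hvw
  have hw := h₁.mem_right hvw
  have hdis : ∀ u ∈ A₂, u ∉ A₁ := fun u hu hu' => Finset.disjoint_left.1 hd hu' hu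
  -- collapse everything outside `A₁` to the vertex `a`
  let r : V → V := fun u => if u ∈ A₁ then u else a
  have key : (H₁.deleteEdges {s(v, w)}).Reachable v (r w) := by
    refine reachable_induction (P := fun u => (H₁.deleteEdges {s(v, w)}).Reachable v (r u)) hr
      (by simp only [r, if_pos hv]; exact SimpleGraph.Reachable.refl _) fun u x hu hux => ?_
    obtain ⟨hux, hne⟩ := SimpleGraph.deleteEdges_adj.1 hux
    rcases hG u x hux with h | h | h
    · have h3 : (H₁.deleteEdges {s(v, w)}).Adj u x := SimpleGraph.deleteEdges_adj.2 ⟨h, hne⟩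
      simp only [r, if_pos (h₁.mem _ _ h), if_pos (h₁.mem_right h)] at hu ⊢
      exact hu.trans h3.reachable
    · simp only [r, if_neg (hdis _ (h₂.mem _ _ h)), if_neg (hdis _ (h₂.mem_right h))] at hu ⊢
      exact hu
    · rcases Sym2.eq_iff.1 h with ⟨rfl, rfl⟩ | ⟨rfl, rfl⟩
      · simp only [r, if_pos ha, if_neg (hdis _ hb)] at hu ⊢
        exact hu
      · simp only [r, if_pos ha, if_neg (hdis _ hb)] at hu ⊢
        exact hu
  simp only [r, if_pos hw] at key
  exact h₁.bridge v w hvw key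

omit [DecidableEq V] in
theorem mem_left_of_reachable (h₁ : IsTreeOn H₁ A₁) (h₂ : IsTreeOn H₂ A₂) (hd : Disjoint A₁ A₂)
    (ha : a ∈ A₁) (hG : ∀ v w, G.Adj v w → H₁.Adj v w ∨ H₂.Adj v w ∨ s(v, w) = s(a, b)) {v : V}
    (hr : (G.deleteEdges {s(a, b)}).Reachable a v) : v ∈ A₁ := by
  refine reachable_induction hr ha fun u w hu huw => ?_
  obtain ⟨huw, hne⟩ := SimpleGraph.deleteEdges_adj.1 huw
  rcases hG u w huw with h | h | h
  · exact h₁.mem_right h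
  · exact absurd (h₂.mem _ _ h) (Finset.disjoint_left.1 hd hu)
  · exact absurd h hne

theorem IsTreeOn.join (h₁ : IsTreeOn H₁ A₁) (h₂ : IsTreeOn H₂ A₂) (hd : Disjoint A₁ A₂)
    (ha : a ∈ A₁) (hb : b ∈ A₂)
    (hG : ∀ v w, G.Adj v w ↔ H₁.Adj v w ∨ H₂.Adj v w ∨ s(v, w) = s(a, b)) :
    IsTreeOn G (A₁ ∪ A₂) where
  nonempty := ⟨a, Finset.mem_union_left _ ha⟩
  mem v w hvw := by
    rcases (hG v w).1 hvw with h | h | h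
    · exact Finset.mem_union_left _ (h₁.mem _ _ h)
    · exact Finset.mem_union_right _ (h₂.mem _ _ h)
    · rcases Sym2.eq_iff.1 h with ⟨rfl, rfl⟩ | ⟨rfl, rfl⟩
      · exact Finset.mem_union_left _ ha
      · exact Finset.mem_union_right _ hb
  reachable := by
    have hab : G.Adj a b := (hG a b).2 (Or.inr (Or.inr rfl))
    have h : ∀ v ∈ A₁ ∪ A₂, G.Reachable a v := by
      intro v hv
      rcases Finset.mem_union.1 hv with hv | hv
      · exact (h₁.reachable a ha v hv).mono fun v w h => (hG v w).2 (Or.inl h)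
      · exact hab.reachable.trans
          ((h₂.reachable b hb v hv).mono fun v w h => (hG v w).2 (Or.inr (Or.inl h)))
    exact fun v hv w hw => (h v hv).symm.trans (h w hw)
  bridge v w hvw := by
    have hl : ¬(G.deleteEdges {s(a, b)}).Reachable a b := fun hr =>
      Finset.disjoint_left.1 hd
        (mem_left_of_reachable h₁ h₂ hd ha (fun v w h => (hG v w).1 h) hr) hb
    rcases (hG v w).1 hvw with h | h | h
    · exact not_reachable_of_join h₁ h₂ hd hb ha (fun v w h => (hG v w).1 h) h
    · refine not_reachable_of_join (a := b) (b := a) h₂ h₁ hd.symm ha hb (fun v w h => ?_) h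
      rw [Sym2.eq_swap (a := b)]
      rcases (hG v w).1 h with h | h | h
      exacts [Or.inr (Or.inl h), Or.inl h, Or.inr (Or.inr h)]
    · rw [h]
      rcases Sym2.eq_iff.1 h with ⟨rfl, rfl⟩ | ⟨rfl, rfl⟩
      · exact hl
      · exact fun hr => hl hr.symm

theorem cutSide_join (h₁ : IsTreeOn H₁ A₁) (h₂ : IsTreeOn H₂ A₂) (hd : Disjoint A₁ A₂)
    (ha : a ∈ A₁) (hb : b ∈ A₂)
    (hG : ∀ v w, G.Adj v w ↔ H₁.Adj v w ∨ H₂.Adj v w ∨ s(v, w) = s(a, b)) :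
    cutSide G (A₁ ∪ A₂) a b = A₁ := by
  ext v
  rw [mem_cutSide]
  refine ⟨fun h => mem_left_of_reachable h₁ h₂ hd ha (fun v w h => (hG v w).1 h) h.2, fun hv =>
    ⟨Finset.mem_union_left _ hv, (h₁.reachable a ha v hv).mono fun v w h => ?_⟩⟩
  refine SimpleGraph.deleteEdges_adj.2 ⟨(hG v w).2 (Or.inl h), fun he => ?_⟩
  rcases Sym2.eq_iff.1 (Set.mem_singleton_iff.1 he) with ⟨rfl, rfl⟩ | ⟨rfl, rfl⟩
  · exact Finset.disjoint_left.1 hd (h₁.mem_right h) hb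
  · exact Finset.disjoint_left.1 hd (h₁.mem _ _ h) hb

end Join

end TreeOn

/-! ### Edge-labelled, vertex-coloured trees and their weights. -/

section LabelledTrees

variable {V : Type*} {ι : Type*}

/-- The graph whose edges are the labelled pairs. -/
def labelGraph (l : Sym2 V → Option ι) : SimpleGraph V :=
  SimpleGraph.fromEdgeSet {e | l e ≠ none}

theorem labelGraph_adj {l : Sym2 V → Option ι} {v w : V} :
    (labelGraph l).Adj v w ↔ l s(v, w) ≠ none ∧ v ≠ w := by
  simp [labelGraph]

/-- An edge-labelled, vertex-coloured tree on `A ⊆ V`; vertices outside `A` are white. -/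
structure IsLabelledTree (A : Finset V) (p : (Sym2 V → Option ι) × (V → Colour)) : Prop where
  isTreeOn : IsTreeOn (labelGraph p.1) A
  diag : ∀ v, p.1 s(v, v) = none
  proper : ∀ v w, (labelGraph p.1).Adj v w → p.2 v ≠ p.2 w
  outside : ∀ v, v ∉ A → p.2 v = .white

theorem IsLabelledTree.adj_iff {A : Finset V} {p : (Sym2 V → Option ι) × (V → Colour)}
    (h : IsLabelledTree A p) {v w : V} : (labelGraph p.1).Adj v w ↔ p.1 s(v, w) ≠ none := by
  rw [labelGraph_adj]
  refine ⟨fun h => h.1, fun hn => ⟨hn, ?_⟩⟩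
  rintro rfl
  exact hn (h.diag v)

theorem IsLabelledTree.mem {A : Finset V} {p : (Sym2 V → Option ι) × (V → Colour)}
    (h : IsLabelledTree A p) {v w : V} (hn : p.1 s(v, w) ≠ none) : v ∈ A ∧ w ∈ A :=
  ⟨h.isTreeOn.mem _ _ (h.adj_iff.2 hn), h.isTreeOn.mem_right (h.adj_iff.2 hn)⟩

theorem IsLabelledTree.eq_none {A : Finset V} {p : (Sym2 V → Option ι) × (V → Colour)}
    (h : IsLabelledTree A p) {v w : V} (hn : v ∉ A ∨ w ∉ A) : p.1 s(v, w) = none := by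
  by_contra hne
  exact hn.elim (fun h' => h' (h.mem hne).1) fun h' => h' (h.mem hne).2

variable [DecidableEq V]

/-- The restriction of a labelled tree to a set of vertices. -/
def restrictTree (p : (Sym2 V → Option ι) × (V → Colour)) (B : Finset V) :
    (Sym2 V → Option ι) × (V → Colour) :=
  (fun e => if e ∈ B.sym2 then p.1 e else none, fun v => if v ∈ B then p.2 v else .white)

/-- Two labelled trees joined by a new edge `s(a, b)` with label `i`. -/
def joinTree (A : Finset V) (p q : (Sym2 V → Option ι) × (V → Colour)) (a b : V) (i : ι) :
    (Sym2 V → Option ι) × (V → Colour) :=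
  (fun e => if e = s(a, b) then some i else (p.1 e).or (q.1 e),
    fun v => if v ∈ A then p.2 v else q.2 v)

theorem restrictTree_fst (p : (Sym2 V → Option ι) × (V → Colour)) (B : Finset V) (v w : V) :
    (restrictTree p B).1 s(v, w) = if v ∈ B ∧ w ∈ B then p.1 s(v, w) else none := by
  simp [restrictTree]

theorem isLabelledTree_restrictTree {p : (Sym2 V → Option ι) × (V → Colour)} {A B : Finset V}
    (h : IsLabelledTree A p) (hB : IsTreeOn (labelGraph (restrictTree p B).1) B) :
    IsLabelledTree B (restrictTree p B) where
  isTreeOn := hB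
  diag v := by simp [restrictTree_fst, h.diag]
  proper v w hvw := by
    have hv := hB.mem _ _ hvw
    have hw := hB.mem_right hvw
    rw [labelGraph_adj, restrictTree_fst, if_pos ⟨hv, hw⟩] at hvw
    simp only [restrictTree, if_pos hv, if_pos hw]
    exact h.proper v w (labelGraph_adj.2 hvw)
  outside v hv := by simp [restrictTree, hv]

theorem labelGraph_restrictTree_adj {p : (Sym2 V → Option ι) × (V → Colour)} {B : Finset V}
    {v w : V} : (labelGraph (restrictTree p B).1).Adj v w ↔
      (labelGraph p.1).Adj v w ∧ v ∈ B ∧ w ∈ B := by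
  rw [labelGraph_adj, labelGraph_adj, restrictTree_fst]
  split_ifs with h <;> simp [h]

theorem IsLabelledTree.restrict_left {p : (Sym2 V → Option ι) × (V → Colour)} {A : Finset V}
    (h : IsLabelledTree A p) {a b : V} (hab : (labelGraph p.1).Adj a b) :
    IsLabelledTree (cutSide (labelGraph p.1) A a b)
      (restrictTree p (cutSide (labelGraph p.1) A a b)) :=
  isLabelledTree_restrictTree h (h.isTreeOn.cut_left hab fun _ _ => labelGraph_restrictTree_adj)

theorem IsLabelledTree.restrict_right {p : (Sym2 V → Option ι) × (V → Colour)} {A : Finset V}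
    (h : IsLabelledTree A p) {a b : V} (hab : (labelGraph p.1).Adj a b) :
    IsLabelledTree (A \ cutSide (labelGraph p.1) A a b)
      (restrictTree p (A \ cutSide (labelGraph p.1) A a b)) :=
  isLabelledTree_restrictTree h (h.isTreeOn.cut_right hab fun _ _ => labelGraph_restrictTree_adj)

/-- With the next lemmas this makes cutting and joining mutually inverse. The convention that
colours are white off the vertex set makes the recovery exact. -/
theorem joinTree_restrictTree {p : (Sym2 V → Option ι) × (V → Colour)} {A : Finset V}
    (h : IsLabelledTree A p) {a b : V} {i : ι} (hi : p.1 s(a, b) = some i) :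
    joinTree (cutSide (labelGraph p.1) A a b) (restrictTree p (cutSide (labelGraph p.1) A a b))
      (restrictTree p (A \ cutSide (labelGraph p.1) A a b)) a b i = p := by
  refine Prod.ext (funext fun e => ?_) (funext fun v => ?_)
  · induction e with | _ v w
    change (if s(v, w) = s(a, b) then some i else
      ((restrictTree p _).1 s(v, w)).or ((restrictTree p _).1 s(v, w))) = _
    split_ifs with he
    · rw [he, hi]
    · rw [restrictTree_fst, restrictTree_fst]
      by_cases hn : p.1 s(v, w) = none
      · simp [hn]
      · rcases h.isTreeOn.adj_cases (a := a) (b := b) (h.adj_iff.2 hn) with h1 | h1 | h1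
        · rw [if_pos h1, if_neg fun h2 => (Finset.mem_sdiff.1 h2.1).2 h1.1, Option.or_none]
        · rw [if_pos h1, if_neg fun h2 => (Finset.mem_sdiff.1 h1.1).2 h2.1, Option.none_or]
        · exact absurd h1 he
  · change (if v ∈ _ then (restrictTree p _).2 v else (restrictTree p _).2 v) = _
    simp only [restrictTree]
    split_ifs with h1 h2
    · rfl
    · rfl
    · exact (h.outside v fun hA => h2 (Finset.mem_sdiff.2 ⟨hA, h1⟩)).symm

section Join

variable {A B : Finset V} {p q : (Sym2 V → Option ι) × (V → Colour)} {a b : V} {i : ι}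

theorem joinTree_fst (v w : V) : (joinTree A p q a b i).1 s(v, w) =
    if s(v, w) = s(a, b) then some i else (p.1 s(v, w)).or (q.1 s(v, w)) := rfl

theorem joinTree_adj (hp : IsLabelledTree A p) (hq : IsLabelledTree B q) (hab : a ≠ b) (v w : V) :
    (labelGraph (joinTree A p q a b i).1).Adj v w ↔
      (labelGraph p.1).Adj v w ∨ (labelGraph q.1).Adj v w ∨ s(v, w) = s(a, b) := by
  rw [hp.adj_iff, hq.adj_iff, labelGraph_adj, joinTree_fst]
  split_ifs with he
  · have : v ≠ w := by
      rintro rfl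
      rcases Sym2.eq_iff.1 he with ⟨rfl, rfl⟩ | ⟨rfl, rfl⟩ <;> exact hab rfl
    simp [he, this]
  · by_cases hvw : v = w
    · subst hvw
      simp [hp.diag, hq.diag, he]
    · simp [he, hvw, Option.or_eq_none_iff]
      tauto

theorem joinTree_colour_left {v : V} (hv : v ∈ A) : (joinTree A p q a b i).2 v = p.2 v := by
  simp [joinTree, hv]

theorem joinTree_colour_right (hd : Disjoint A B) {v : V} (hv : v ∈ B) :
    (joinTree A p q a b i).2 v = q.2 v := by
  simp [joinTree, Finset.disjoint_right.1 hd hv]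

theorem IsLabelledTree.join (hp : IsLabelledTree A p) (hq : IsLabelledTree B q)
    (hd : Disjoint A B) (ha : a ∈ A) (hb : b ∈ B) (hc : p.2 a ≠ q.2 b) :
    IsLabelledTree (A ∪ B) (joinTree A p q a b i) where
  isTreeOn := hp.isTreeOn.join hq.isTreeOn hd ha hb
    (joinTree_adj hp hq fun h => Finset.disjoint_left.1 hd ha (h ▸ hb))
  diag v := by
    rw [joinTree_fst, hp.diag, hq.diag, if_neg, Option.or_none]
    intro he
    rcases Sym2.eq_iff.1 he with ⟨rfl, rfl⟩ | ⟨rfl, rfl⟩ <;>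
      exact Finset.disjoint_left.1 hd ha hb
  proper v w hvw := by
    have hne : a ≠ b := fun h => Finset.disjoint_left.1 hd ha (h ▸ hb)
    rw [joinTree_adj hp hq hne] at hvw
    rcases hvw with h | h | h
    · rw [joinTree_colour_left (hp.isTreeOn.mem _ _ h), joinTree_colour_left (hp.isTreeOn.mem_right h)]
      exact hp.proper _ _ h
    · rw [joinTree_colour_right hd (hq.isTreeOn.mem _ _ h),
        joinTree_colour_right hd (hq.isTreeOn.mem_right h)]
      exact hq.proper _ _ h
    · rcases Sym2.eq_iff.1 h with ⟨rfl, rfl⟩ | ⟨rfl, rfl⟩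
      · rwa [joinTree_colour_left ha, joinTree_colour_right hd hb]
      · rw [joinTree_colour_left ha, joinTree_colour_right hd hb]
        exact hc.symm
  outside v hv := by
    rw [Finset.mem_union, not_or] at hv
    simp [joinTree, hv.1, hq.outside v hv.2]

theorem cutSide_joinTree (hp : IsLabelledTree A p) (hq : IsLabelledTree B q)
    (hd : Disjoint A B) (ha : a ∈ A) (hb : b ∈ B) :
    cutSide (labelGraph (joinTree A p q a b i).1) (A ∪ B) a b = A :=
  cutSide_join hp.isTreeOn hq.isTreeOn hd ha hb
    (joinTree_adj hp hq fun h => Finset.disjoint_left.1 hd ha (h ▸ hb))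

theorem restrictTree_joinTree_left (hp : IsLabelledTree A p) (hq : IsLabelledTree B q)
    (hd : Disjoint A B) (hb : b ∈ B) :
    restrictTree (joinTree A p q a b i) A = p := by
  refine Prod.ext (funext fun e => ?_) (funext fun v => ?_)
  · induction e with | _ v w
    rw [restrictTree_fst]
    split_ifs with h
    · rw [joinTree_fst, hq.eq_none (Or.inl (Finset.disjoint_left.1 hd h.1)), Option.or_none, if_neg]
      intro he
      rcases Sym2.eq_iff.1 he with ⟨rfl, rfl⟩ | ⟨rfl, rfl⟩
      · exact Finset.disjoint_left.1 hd h.2 hb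
      · exact Finset.disjoint_left.1 hd h.1 hb
    · rw [hp.eq_none (by tauto)]
  · simp only [restrictTree, joinTree]
    split_ifs with h
    · rfl
    · exact (hp.outside v h).symm

theorem restrictTree_joinTree_right (hp : IsLabelledTree A p) (hq : IsLabelledTree B q)
    (hd : Disjoint A B) (ha : a ∈ A) :
    restrictTree (joinTree A p q a b i) B = q := by
  refine Prod.ext (funext fun e => ?_) (funext fun v => ?_)
  · induction e with | _ v w
    rw [restrictTree_fst]
    split_ifs with h
    · rw [joinTree_fst, hp.eq_none (Or.inl (Finset.disjoint_right.1 hd h.1)), Option.none_or, if_neg]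
      intro he
      rcases Sym2.eq_iff.1 he with ⟨rfl, rfl⟩ | ⟨rfl, rfl⟩
      · exact Finset.disjoint_right.1 hd h.1 ha
      · exact Finset.disjoint_right.1 hd h.2 ha
    · rw [hq.eq_none (by tauto)]
  · simp only [restrictTree, joinTree]
    split_ifs with h h'
    · exact absurd h (Finset.disjoint_left.1 hd h')
    · rfl
    · exact (hq.outside v h).symm

end Join

section Weight

variable [Fintype V] {R : Type*} [CommRing R]

/-- The label as a multiset with at most one element. -/
def labelMultiset : Option ι → Multiset ι
  | none => 0
  | some i => {i}

/-- The multiset of the labels of the edges at `v`. -/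
def labelsAt (l : Sym2 V → Option ι) (v : V) : Multiset ι :=
  ∑ w, labelMultiset (l s(v, w))

/-- The weight of a labelled tree with additional legs `m`. -/
def treeWeight (J : Colour → Multiset ι → R) (A : Finset V)
    (p : (Sym2 V → Option ι) × (V → Colour)) (m : V → Multiset ι) : R :=
  ∏ v ∈ A, J (p.2 v) (m v + labelsAt p.1 v)

variable {A B : Finset V} {p q : (Sym2 V → Option ι) × (V → Colour)} {a b : V} {i : ι}

theorem labelsAt_joinTree_left (hp : IsLabelledTree A p) (hq : IsLabelledTree B q)
    (hd : Disjoint A B) (ha : a ∈ A) (hb : b ∈ B) {v : V} (hv : v ∈ A) :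
    labelsAt (joinTree A p q a b i).1 v =
      (Pi.single a {i} : V → Multiset ι) v + labelsAt p.1 v := by
  have h : ∀ w, labelMultiset ((joinTree A p q a b i).1 s(v, w)) =
      (if w = b then (Pi.single a {i} : V → Multiset ι) v else 0) + labelMultiset (p.1 s(v, w)) := by
    intro w
    rw [joinTree_fst]
    have hvb : v ≠ b := fun h => Finset.disjoint_left.1 hd hv (h ▸ hb)
    by_cases hva : v = a
    · subst hva
      by_cases hwb : w = b
      · subst hwb
        simp [hp.eq_none (Or.inr (Finset.disjoint_right.1 hd hb)), labelMultiset]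
      · simp [hwb, hvb, hq.eq_none (Or.inl (Finset.disjoint_left.1 hd hv))]
    · simp [hva, hvb, hq.eq_none (Or.inl (Finset.disjoint_left.1 hd hv))]
  simp only [labelsAt, h, Finset.sum_add_distrib, Finset.sum_ite_eq', Finset.mem_univ, if_true]

theorem labelsAt_joinTree_right (hp : IsLabelledTree A p) (hq : IsLabelledTree B q)
    (hd : Disjoint A B) (ha : a ∈ A) (hb : b ∈ B) {v : V} (hv : v ∈ B) :
    labelsAt (joinTree A p q a b i).1 v =
      (Pi.single b {i} : V → Multiset ι) v + labelsAt q.1 v := by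
  have h : ∀ w, labelMultiset ((joinTree A p q a b i).1 s(v, w)) =
      (if w = a then (Pi.single b {i} : V → Multiset ι) v else 0) + labelMultiset (q.1 s(v, w)) := by
    intro w
    rw [joinTree_fst]
    have hva : v ≠ a := fun h => Finset.disjoint_right.1 hd hv (h ▸ ha)
    by_cases hvb : v = b
    · subst hvb
      by_cases hwa : w = a
      · subst hwa
        simp [hq.eq_none (Or.inr (Finset.disjoint_left.1 hd ha)), labelMultiset]
      · simp [hwa, hva, hp.eq_none (Or.inl (Finset.disjoint_right.1 hd hv))]
    · simp [hva, hvb, hp.eq_none (Or.inl (Finset.disjoint_right.1 hd hv))]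
  simp only [labelsAt, h, Finset.sum_add_distrib, Finset.sum_ite_eq', Finset.mem_univ, if_true]

/-- The two halves of the new edge become legs labelled `i` at `a` and at `b`, and the product over
vertices factors. -/
theorem treeWeight_joinTree (J : Colour → Multiset ι → R) (hp : IsLabelledTree A p)
    (hq : IsLabelledTree B q) (hd : Disjoint A B) (ha : a ∈ A) (hb : b ∈ B) :
    treeWeight J (A ∪ B) (joinTree A p q a b i) 0 =
      treeWeight J A p (Pi.single a {i}) * treeWeight J B q (Pi.single b {i}) := by
  rw [treeWeight, Finset.prod_union hd]
  congr 1
  · refine Finset.prod_congr rfl fun v hv => ?_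
    rw [joinTree_colour_left hv, labelsAt_joinTree_left hp hq hd ha hb hv, Pi.zero_apply, zero_add]
  · refine Finset.prod_congr rfl fun v hv => ?_
    rw [joinTree_colour_right hd hv, labelsAt_joinTree_right hp hq hd ha hb hv, Pi.zero_apply,
      zero_add]

theorem derivation_prod {K : Type*} [CommRing K] [Algebra K R] (D : Derivation K R R)
    {κ : Type*} [DecidableEq κ] (s : Finset κ) (f : κ → R) :
    D (∏ v ∈ s, f v) = ∑ a ∈ s, ∏ v ∈ s, if v = a then D (f v) else f v := by
  induction s using Finset.induction_on with
  | empty => simp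
  | insert x s hx ih =>
    rw [Finset.prod_insert hx, Derivation.leibniz, ih, Finset.sum_insert hx, Finset.prod_insert hx,
      if_pos rfl, smul_eq_mul, smul_eq_mul, add_comm, Finset.mul_sum]
    congr 1
    · rw [mul_comm]
      congr 1
      refine Finset.prod_congr rfl fun v hv => ?_
      rw [if_neg]
      rintro rfl
      exact hx hv
    · refine Finset.sum_congr rfl fun a ha => ?_
      rw [Finset.prod_insert hx, if_neg]
      rintro rfl
      exact hx ha

/-- By the Leibniz rule the derivative attaches one leg labelled `i` to each vertex of colour `c` in
turn. -/
theorem derivation_treeWeight {K : Type*} [CommRing K] [Algebra K R] {J : Colour → Multiset ι → R}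
    {D : Derivation K R R} {c : Colour}
    (hD : ∀ c' l, D (J c' l) = if c = c' then J c' (i ::ₘ l) else 0) :
    D (treeWeight J A p 0) =
      ∑ a ∈ A with p.2 a = c, treeWeight J A p (Pi.single a {i}) := by
  rw [treeWeight, derivation_prod, Finset.sum_filter]
  refine Finset.sum_congr rfl fun a ha => ?_
  simp only [hD]
  split_ifs with h
  · refine Finset.prod_congr rfl fun v hv => ?_
    by_cases hva : v = a
    · subst hva
      simp [h]
    · simp [hva]
  · refine Finset.prod_eq_zero ha ?_
    rw [if_pos rfl, if_neg fun h' => h h'.symm]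

end Weight

end LabelledTrees

/-! ### The recursion for tree sums. -/

section TreeSum

variable {V : Type*} [DecidableEq V] [Fintype V] {ι : Type*} [Fintype ι] {R : Type*} [CommRing R]

open Classical in
/-- The sum of the weights of all labelled trees on `A`. -/
def treeSum (J : Colour → Multiset ι → R) (A : Finset V) : R :=
  ∑ p : (Sym2 V → Option ι) × (V → Colour) with IsLabelledTree A p, treeWeight J A p 0

/-- The labelled edge `t.2.2` of `p` from a white vertex `t.1` to a black vertex `t.2.1`. -/
def IsLabelledEdge (p : (Sym2 V → Option ι) × (V → Colour)) (t : V × V × ι) : Prop :=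
  p.2 t.1 = .white ∧ p.2 t.2.1 = .black ∧ p.1 s(t.1, t.2.1) = some t.2.2

-- Each edge has exactly one white end, so orienting edges from white to black counts each edge
-- once.
omit [DecidableEq V] in
open Classical in
theorem card_labelledEdges {A : Finset V} {p : (Sym2 V → Option ι) × (V → Colour)}
    (h : IsLabelledTree A p) :
    (Finset.univ.filter fun t => IsLabelledEdge p t).card + 1 = A.card := by
  rw [← h.isTreeOn.card_edgeFinset]
  congr 1
  refine Finset.card_bij (fun t _ => s(t.1, t.2.1)) ?_ ?_ ?_
  · rintro ⟨a, b, i⟩ ht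
    rw [Finset.mem_filter] at ht
    obtain ⟨-, -, -, ht⟩ := ht
    rw [SimpleGraph.mem_edgeFinset, SimpleGraph.mem_edgeSet, h.adj_iff]
    simp_all
  · rintro ⟨a, b, i⟩ ht ⟨a', b', i'⟩ ht' he
    rw [Finset.mem_filter] at ht ht'
    obtain ⟨-, ha, hb, hi⟩ := ht
    obtain ⟨-, ha', hb', hi'⟩ := ht'
    rcases Sym2.eq_iff.1 he with ⟨h1, h2⟩ | ⟨h1, h2⟩
    · simp only at ha hb hi ha' hb' hi' h1 h2
      subst h1 h2
      rw [hi, Option.some.injEq] at hi'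
      rw [hi']
    · simp only at ha hb hi ha' hb' hi' h1 h2
      subst h1 h2
      exact absurd (ha.symm.trans hb') (by decide)
  · intro e he
    induction e with | _ v w
    rw [SimpleGraph.mem_edgeFinset, SimpleGraph.mem_edgeSet] at he
    have hc := h.proper _ _ he
    obtain ⟨i, hi⟩ := Option.ne_none_iff_exists'.1 (h.adj_iff.1 he)
    rcases hv : p.2 v with _ | _ <;> rcases hw : p.2 w with _ | _
    · exact absurd (hv.trans hw.symm) hc
    · exact ⟨(v, w, i), Finset.mem_filter.2 ⟨Finset.mem_univ _, hv, hw, hi⟩, rfl⟩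
    · exact ⟨(w, v, i), Finset.mem_filter.2 ⟨Finset.mem_univ _, hw, hv, Sym2.eq_swap ▸ hi⟩, Sym2.eq_swap⟩
    · exact absurd (hv.trans hw.symm) hc

variable {J : Colour → Multiset ι → R} {K : Type*} [CommRing K] [Algebra K R]
  {D : Colour → ι → Derivation K R R}

open Classical in
theorem derivation_treeSum
    (hD : ∀ c i c' l, D c i (J c' l) = if c = c' then J c' (i ::ₘ l) else 0) (A : Finset V)
    (c : Colour) (i : ι) :
    D c i (treeSum J A) =
      ∑ t : ((Sym2 V → Option ι) × (V → Colour)) × V with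
        IsLabelledTree A t.1 ∧ t.2 ∈ A ∧ t.1.2 t.2 = c, treeWeight J A t.1 (Pi.single t.2 {i}) := by
  rw [treeSum, map_sum]
  simp_rw [derivation_treeWeight (hD c i)]
  rw [Finset.sum_sigma']
  refine Finset.sum_bij' (fun t _ => (t.1, t.2)) (fun t _ => ⟨t.1, t.2⟩) ?_ ?_ ?_ ?_ ?_ <;> simp

open Classical in
/-- Cutting a tree at an edge. -/
theorem card_nsmul_treeSum
    (hD : ∀ c i c' l, D c i (J c' l) = if c = c' then J c' (i ::ₘ l) else 0) {A : Finset V} {n : ℕ}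
    (hA : A.card = n + 1) :
    n • treeSum J A = ∑ B ∈ A.powerset, ∑ i,
      D .white i (treeSum J B) * D .black i (treeSum J (A \ B)) := by
  -- The factor `n` counts the choices of a marked edge in each tree.
  have h1 : n • treeSum J A =
      ∑ x : ((Sym2 V → Option ι) × (V → Colour)) × V × V × ι with
        IsLabelledTree A x.1 ∧ IsLabelledEdge x.1 x.2, treeWeight J A x.1 0 := by
    have h2 : ∀ p ∈ Finset.univ.filter (fun p : (Sym2 V → Option ι) × (V → Colour) =>
        IsLabelledTree A p), n • treeWeight J A p 0 =
        ∑ t ∈ Finset.univ.filter (fun t => IsLabelledEdge p t), treeWeight J A p 0 := by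
      intro p hp
      have := card_labelledEdges (Finset.mem_filter.1 hp).2
      rw [Finset.sum_const]
      congr 1
      omega
    rw [treeSum, Finset.smul_sum, Finset.sum_congr rfl h2, Finset.sum_sigma']
    refine Finset.sum_bij' (fun t _ => (t.1, t.2)) (fun t _ => ⟨t.1, t.2⟩) ?_ ?_ ?_ ?_ ?_ <;> simp
  have h2 : ∑ B ∈ A.powerset, ∑ i, D .white i (treeSum J B) * D .black i (treeSum J (A \ B)) =
      ∑ x : Finset V × ι × (((Sym2 V → Option ι) × (V → Colour)) × V) ×
          (((Sym2 V → Option ι) × (V → Colour)) × V) with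
        x.1 ⊆ A ∧ (IsLabelledTree x.1 x.2.2.1.1 ∧ x.2.2.1.2 ∈ x.1 ∧
          x.2.2.1.1.2 x.2.2.1.2 = .white) ∧
        (IsLabelledTree (A \ x.1) x.2.2.2.1 ∧ x.2.2.2.2 ∈ A \ x.1 ∧
          x.2.2.2.1.2 x.2.2.2.2 = .black),
        treeWeight J x.1 x.2.2.1.1 (Pi.single x.2.2.1.2 {x.2.1}) *
          treeWeight J (A \ x.1) x.2.2.2.1 (Pi.single x.2.2.2.2 {x.2.1}) := by
    simp_rw [derivation_treeSum hD, Finset.sum_mul_sum, ← Finset.sum_product']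
    rw [Finset.sum_sigma']
    refine Finset.sum_bij' (fun t _ => (t.1, t.2)) (fun x _ => ⟨x.1, x.2⟩) ?_ ?_ ?_ ?_ ?_
    · rintro ⟨B, i, ⟨p, a⟩, ⟨q, b⟩⟩ h
      simpa using h
    · rintro ⟨B, i, ⟨p, a⟩, ⟨q, b⟩⟩ h
      simpa using h
    all_goals simp
  rw [h1, h2]
  -- A tree with a marked edge corresponds to the white side `B`, the label of the edge, and the two
  -- pieces with the former ends of the edge marked.
  refine Finset.sum_bij'
    (fun x _ => (cutSide (labelGraph x.1.1) A x.2.1 x.2.2.1, x.2.2.2,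
      (restrictTree x.1 (cutSide (labelGraph x.1.1) A x.2.1 x.2.2.1), x.2.1),
      (restrictTree x.1 (A \ cutSide (labelGraph x.1.1) A x.2.1 x.2.2.1), x.2.2.1)))
    (fun x _ => (joinTree x.1 x.2.2.1.1 x.2.2.2.1 x.2.2.1.2 x.2.2.2.2 x.2.1,
      x.2.2.1.2, x.2.2.2.2, x.2.1)) ?_ ?_ ?_ ?_ ?_
  · rintro ⟨p, a, b, i⟩ hx
    obtain ⟨-, ht, ha, hb, hi⟩ := Finset.mem_filter.1 hx
    simp only at ht ha hb hi
    have hab : (labelGraph p.1).Adj a b := ht.adj_iff.2 (by simp [hi])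
    have hsub : cutSide (labelGraph p.1) A a b ⊆ A := fun v hv => (mem_cutSide.1 hv).1
    have ham := ht.isTreeOn.left_mem_cutSide hab
    have hbm : b ∈ A \ cutSide (labelGraph p.1) A a b :=
      Finset.mem_sdiff.2 ⟨ht.isTreeOn.mem_right hab, ht.isTreeOn.right_notMem_cutSide hab⟩
    refine Finset.mem_filter.2 ⟨Finset.mem_univ _, hsub, ⟨ht.restrict_left hab, ham, ?_⟩,
      ht.restrict_right hab, hbm, ?_⟩
    · simp [restrictTree, ham, ha]
    · simp only [restrictTree]
      rw [if_pos hbm, hb]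
  · rintro ⟨B, i, ⟨p, a⟩, ⟨q, b⟩⟩ hx
    obtain ⟨-, hB, ⟨hp, ha, hpa⟩, hq, hb, hqb⟩ := Finset.mem_filter.1 hx
    simp only at hB hp ha hpa hq hb hqb
    have hd : Disjoint B (A \ B) := Finset.disjoint_sdiff
    have hj := hp.join (i := i) hq hd ha hb (by rw [hpa, hqb]; decide)
    rw [Finset.union_sdiff_of_subset hB] at hj
    refine Finset.mem_filter.2 ⟨Finset.mem_univ _, hj, ?_, ?_, ?_⟩
    · exact (joinTree_colour_left ha).trans hpa
    · exact (joinTree_colour_right hd hb).trans hqb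
    · simp [joinTree_fst]
  · rintro ⟨p, a, b, i⟩ hx
    obtain ⟨-, ht, ha, hb, hi⟩ := Finset.mem_filter.1 hx
    simp only at ht ha hb hi
    simp only [joinTree_restrictTree ht hi]
  · rintro ⟨B, i, ⟨p, a⟩, ⟨q, b⟩⟩ hx
    obtain ⟨-, hB, ⟨hp, ha, hpa⟩, hq, hb, hqb⟩ := Finset.mem_filter.1 hx
    simp only at hB hp ha hpa hq hb hqb
    have hd : Disjoint B (A \ B) := Finset.disjoint_sdiff
    have hc := cutSide_joinTree (i := i) hp hq hd ha hb
    rw [Finset.union_sdiff_of_subset hB] at hc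
    simp only [hc, restrictTree_joinTree_left hp hq hd hb, restrictTree_joinTree_right hp hq hd ha]
  · rintro ⟨p, a, b, i⟩ hx
    obtain ⟨-, ht, ha, hb, hi⟩ := Finset.mem_filter.1 hx
    simp only at ht ha hb hi
    have hab : (labelGraph p.1).Adj a b := ht.adj_iff.2 (by simp [hi])
    have hsub : cutSide (labelGraph p.1) A a b ⊆ A := fun v hv => (mem_cutSide.1 hv).1
    have hbm : b ∈ A \ cutSide (labelGraph p.1) A a b :=
      Finset.mem_sdiff.2 ⟨ht.isTreeOn.mem_right hab, ht.isTreeOn.right_notMem_cutSide hab⟩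
    rw [← treeWeight_joinTree J (ht.restrict_left hab) (ht.restrict_right hab)
      Finset.disjoint_sdiff (ht.isTreeOn.left_mem_cutSide hab) hbm, joinTree_restrictTree ht hi,
      Finset.union_sdiff_of_subset hsub]

theorem treeSum_empty (J : Colour → Multiset ι → R) : treeSum J (∅ : Finset V) = 0 := by
  classical
  refine Finset.sum_eq_zero fun p hp => ?_
  exact absurd (Finset.mem_filter.1 hp).2.isTreeOn.nonempty Finset.not_nonempty_empty

theorem treeSum_singleton (J : Colour → Multiset ι → R) (v : V) :
    treeSum J {v} = J .white 0 + J .black 0 := by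
  classical
  have h : ∀ c, IsLabelledTree (ι := ι) {v} (fun _ => none, Function.update (fun _ => .white) v c) :=
    fun c =>
    { isTreeOn :=
        { nonempty := ⟨v, by simp⟩
          mem := fun a b hab => absurd rfl (labelGraph_adj.1 hab).1
          reachable := by
            intro a ha b hb
            rw [Finset.mem_singleton.1 ha, Finset.mem_singleton.1 hb]
          bridge := fun a b hab => absurd rfl (labelGraph_adj.1 hab).1 }
      diag := fun _ => rfl
      proper := fun a b hab => absurd rfl (labelGraph_adj.1 hab).1
      outside := fun w hw => by simp [Finset.mem_singleton.not.1 hw] }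
  have h2 : treeSum J {v} = ∑ c : Colour, J c 0 := by
    refine Finset.sum_bij' (fun p _ => p.2 v)
      (fun c _ => (fun _ => none, Function.update (fun _ => .white) v c)) ?_ ?_ ?_ ?_ ?_
    · simp
    · exact fun c _ => Finset.mem_filter.2 ⟨Finset.mem_univ _, h c⟩
    · intro p hp
      have hp := (Finset.mem_filter.1 hp).2
      refine Prod.ext (funext fun e => ?_) (funext fun w => ?_)
      · induction e with | _ a b
        by_contra hne
        obtain ⟨ha, hb⟩ := hp.mem (Ne.symm hne)
        rw [Finset.mem_singleton.1 ha, Finset.mem_singleton.1 hb, hp.diag] at hne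
        exact hne rfl
      · by_cases hw : w = v
        · subst hw
          simp
        · simp [hw, hp.outside w (by simpa using hw)]
    · simp
    · intro p hp
      have hp := (Finset.mem_filter.1 hp).2
      have hl : labelsAt p.1 v = 0 := by
        refine Finset.sum_eq_zero fun w _ => ?_
        by_cases hw : w = v
        · rw [hw, hp.diag, labelMultiset]
        · rw [hp.eq_none (Or.inr (by simpa using hw)), labelMultiset]
      simp [treeWeight, hl]
  rw [h2, Colour.sum_eq]

/-- A sequence satisfying the recursion of the Hamilton-Jacobi equation is the sequence of the tree
sums. -/
theorem treeSum_eq_factorial_smul [Algebra ℝ R] {D : Colour → ι → Derivation ℝ R R}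
    (hD : ∀ c i c' l, D c i (J c' l) = if c = c' then J c' (i ::ₘ l) else 0) {T : ℕ → R}
    (h0 : T 0 = J .white 0 + J .black 0)
    (hT : ∀ m : ℕ, (m + 1 : ℝ) • T (m + 1) = ∑ ab ∈ Finset.HasAntidiagonal.antidiagonal m, ∑ i,
      D .white i (T ab.1) * D .black i (T ab.2)) (n : ℕ) :
    ∀ A : Finset V, A.card = n + 1 → treeSum J A = (((n + 1)! : ℕ) : ℝ) • T n := by
  induction n using Nat.strong_induction_on with | _ n ih
  intro A hA
  rcases n with _ | n
  · obtain ⟨v, rfl⟩ := Finset.card_eq_one.1 hA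
    rw [treeSum_singleton, h0]
    simp
  -- `E` reindexes by the number of vertices: `j` vertices correspond to `T (j - 1)`, and the empty
  -- set contributes `0`.
  · let E : ℕ → R := fun j => if j = 0 then 0 else (((j)! : ℕ) : ℝ) • T (j - 1)
    have hE : ∀ B : Finset V, B.card < n + 2 → treeSum J B = E B.card := by
      intro B hB
      rcases hc : B.card with _ | j
      · rw [Finset.card_eq_zero.1 hc, treeSum_empty]
        simp [E]
      · simpa [E] using ih j (by omega) B hc
    have key : (n + 1) • treeSum J A = (n + 1 : ℕ) • ((((n + 2)! : ℕ) : ℝ) • T (n + 1)) := by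
      have h1 : ∀ B ∈ A.powerset, ∑ i, D .white i (treeSum J B) * D .black i (treeSum J (A \ B)) =
          ∑ i, D .white i (E B.card) * D .black i (E (A.card - B.card)) := by
        intro B hB
        have hB := Finset.mem_powerset.1 hB
        have hc := Finset.card_sdiff_of_subset hB
        refine Finset.sum_congr rfl fun i _ => ?_
        have hle := Finset.card_le_card hB
        -- For `B = ∅` and `B = A` one factor is the tree sum of `A` itself, out of reach of the
        -- induction hypothesis; the other factor is an empty tree sum, so the product vanishes.
        by_cases h3 : B.card = 0
        · rw [Finset.card_eq_zero.1 h3, treeSum_empty]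
          simp [E]
        by_cases h4 : B.card = n + 2
        · have : A \ B = ∅ := by
            rw [← Finset.card_eq_zero]
            omega
          rw [this, treeSum_empty, hA, h4]
          simp [E]
        rw [hE B (by omega), hE (A \ B) (by omega), hc]
      rw [card_nsmul_treeSum hD hA, Finset.sum_congr rfl h1,
        Finset.sum_powerset_apply_card
          (fun j => ∑ i, D .white i (E j) * D .black i (E (A.card - j))), hA,
        Finset.sum_range_succ, Finset.sum_range_succ']
      have h2 : ∀ j ∈ Finset.range (n + 1), (n + 2).choose (j + 1) •
          ∑ i, D .white i (E (j + 1)) * D .black i (E (n + 2 - (j + 1))) =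
          (((n + 2)! : ℕ) : ℝ) • ∑ i, D .white i (T j) * D .black i (T (n - j)) := by
        intro j hj
        have hj := Finset.mem_range.1 hj
        have e1 : n + 2 - (j + 1) = n - j + 1 := by omega
        -- The binomial coefficient counts the subsets of a given size and combines with the
        -- factorials of both pieces to `(n + 2)!`.
        have e2 : ((n + 2)! : ℝ) = ((n + 2).choose (j + 1) : ℝ) * ((j + 1)! : ℝ) *
            ((n - j + 1)! : ℝ) := by
          rw [← e1]
          exact_mod_cast (Nat.choose_mul_factorial_mul_factorial (by omega : j + 1 ≤ n + 2)).symm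
        rw [e1, e2]
        simp only [E, Nat.add_eq_zero_iff, one_ne_zero, and_false, if_false, Nat.add_sub_cancel,
          Derivation.map_smul, smul_mul_smul_comm, ← Finset.smul_sum]
        rw [← Nat.cast_smul_eq_nsmul ℝ, smul_smul, mul_assoc]
      rw [Finset.sum_congr rfl h2, ← Finset.smul_sum, ← Finset.Nat.sum_antidiagonal_eq_sum_range_succ
        (fun a b => ∑ i, D .white i (T a) * D .black i (T b)), ← hT, ← Nat.cast_smul_eq_nsmul ℝ,
        smul_comm]
      have hE0 : E 0 = 0 := rfl
      simp only [Nat.sub_self, hE0, map_zero, zero_mul, mul_zero, Finset.sum_const_zero,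
        smul_zero, add_zero]
      rw [← Nat.cast_smul_eq_nsmul ℝ (n + 1), Nat.cast_succ]
    rw [← Nat.cast_smul_eq_nsmul ℝ, ← Nat.cast_smul_eq_nsmul ℝ] at key
    exact (IsUnit.smul_left_cancel (IsUnit.mk0 ((n + 1 : ℕ) : ℝ) (by positivity))).1 key

end TreeSum

/-! ### Universal jets and the tree expansion of the critical value. -/

section UniversalJets

variable {d : ℕ}

/-- The polynomial ring in the jet variables `∂ˡ Sₙ` at the base points of the two colours. -/
abbrev JetRing (d : ℕ) : Type := MvPolynomial (Colour × ℕ × Multiset (Fin d)) ℝ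

/-- The derivation of the jet ring with respect to coordinate `i` of the base point of colour
`c`. -/
def jetDerivation (c : Colour) (i : Fin d) : Derivation ℝ (JetRing d) (JetRing d) :=
  MvPolynomial.mkDerivation ℝ fun x =>
    if c = x.1 then MvPolynomial.X (x.1, x.2.1, i ::ₘ x.2.2) else 0

/-- The formal series `∑ₙ hⁿ gₙ` without its constant term. -/
def positivePart {A : Type*} [Semiring A] (g : ℕ → A) : A⟦X⟧ :=
  PowerSeries.mk fun n => if n = 0 then 0 else g n

theorem X_dvd_positivePart {A : Type*} [CommRing A] (g : ℕ → A) : X ∣ positivePart g := by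
  rw [X_dvd_iff, ← coeff_zero_eq_constantCoeff_apply, positivePart, coeff_mk, if_pos rfl]

theorem coeff_positivePart {A : Type*} [Semiring A] (g : ℕ → A) (n : ℕ) :
    coeff n (positivePart g) = if n = 0 then 0 else g n := coeff_mk _ _

/-- The universal jets. -/
def universalJet (c : Colour) (l : Multiset (Fin d)) : (JetRing d)⟦X⟧ :=
  positivePart fun n => MvPolynomial.X (c, n, l)

/-- This is the hypothesis `hD` of the recursions. It holds because the jet variables of the two
colours are independent. -/
theorem coeffwise_universalJet (c : Colour) (i : Fin d) (c' : Colour) (l : Multiset (Fin d)) :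
    coeffwise (jetDerivation c i) (universalJet c' l) =
      if c = c' then universalJet c' (i ::ₘ l) else 0 := by
  ext1 n
  rw [coeff_coeffwise, universalJet, coeff_positivePart, apply_ite (jetDerivation c i), map_zero,
    jetDerivation, MvPolynomial.mkDerivation_X]
  split_ifs with h1 h2 <;> simp [universalJet, coeff_positivePart, *]

theorem map_treeSum {V : Type*} [DecidableEq V] [Fintype V] {ι : Type*} [Fintype ι]
    {R R' : Type*} [CommRing R] [CommRing R'] (θ : R →+* R') (J : Colour → Multiset ι → R)
    (A : Finset V) : θ (treeSum J A) = treeSum (fun c l => θ (J c l)) A := by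
  simp only [treeSum, treeWeight, map_sum, map_prod]

theorem pow_card_dvd_treeSum {V : Type*} [DecidableEq V] [Fintype V] {ι : Type*} [Fintype ι]
    {R : Type*} [CommRing R] {a : R} {J : Colour → Multiset ι → R} (hJ : ∀ c l, a ∣ J c l)
    (A : Finset V) : a ^ A.card ∣ treeSum J A := by
  refine Finset.dvd_sum fun p _ => ?_
  rw [← Finset.prod_const]
  exact Finset.prod_dvd_prod_of_dvd _ _ fun v _ => hJ _ _

/-- Evaluation of the jet variables at `g`. -/
def evalJet (g : Colour → ℕ → Multiset (Fin d) → ℝ) : JetRing d →ₐ[ℝ] ℝ :=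
  MvPolynomial.aeval fun x => g x.1 x.2.1 x.2.2

/-- Evaluation of the polynomial variable at `1`. -/
def evalOne {A : Type*} [CommRing A] [Algebra ℝ A] : Polynomial A →ₐ[ℝ] A :=
  (Polynomial.aeval (1 : A)).restrictScalars ℝ

theorem mapAlgHom_universalJet (g : Colour → ℕ → Multiset (Fin d) → ℝ) (c : Colour)
    (l : Multiset (Fin d)) :
    mapAlgHom (evalJet g) (universalJet c l) = positivePart fun n => g c n l := by
  ext n
  rw [mapAlgHom_apply, coeff_map, universalJet, coeff_positivePart, coeff_positivePart]
  split_ifs <;> simp [evalJet]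

theorem X_dvd_universalJet (c : Colour) (l : Multiset (Fin d)) : X ∣ universalJet c l :=
  X_dvd_positivePart _

theorem treeSum_universalJet {y : Colour × Fin d → (Polynomial (JetRing d))⟦X⟧}
    (hy : y = gradMap (polyJet universalJet) scale y) (m : ℕ) :
    treeSum universalJet (Finset.univ : Finset (Fin (m + 1))) =
      (((m + 1)! : ℕ) : ℝ) • slice m (critValue (polyJet universalJet) scale y) :=
  treeSum_eq_factorial_smul (D := fun c i => coeffwise (jetDerivation c i))
    (T := fun m => slice m (critValue (polyJet universalJet) scale y)) coeffwise_universalJet (slice_critValue_zero y)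
    (slice_critValue_succ X_dvd_universalJet coeffwise_universalJet hy) m Finset.univ
    (Finset.card_fin _)

/-- The coefficients of the universal critical value are the tree sums. -/
theorem evalJet_critValue (g : Colour → ℕ → Multiset (Fin d) → ℝ)
    {y : Colour × Fin d → (Polynomial (JetRing d))⟦X⟧}
    (hy : y = gradMap (polyJet universalJet) scale y) (n m : ℕ) :
    evalJet g ((coeff n (critValue (polyJet universalJet) scale y)).coeff m) =
      (((m + 1)! : ℕ) : ℝ)⁻¹ * coeff n (treeSum (fun c l => positivePart fun n => g c n l)
        (Finset.univ : Finset (Fin (m + 1)))) := by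
  generalize hW : critValue (polyJet universalJet) scale y = W
  have h1 := congr_arg (mapAlgHom (evalJet g)) (treeSum_universalJet hy m)
  rw [hW, map_smul] at h1
  have h2 : coeff n (mapAlgHom (evalJet g) (slice m W)) = evalJet g ((coeff n W).coeff m) := by
    rw [mapAlgHom_apply, coeff_map, slice, coeff_mk]
    rfl
  have h3 : mapAlgHom (evalJet g) (treeSum universalJet (Finset.univ : Finset (Fin (m + 1)))) =
      treeSum (fun c l => positivePart fun n => g c n l)
        (Finset.univ : Finset (Fin (m + 1))) := by
    refine (map_treeSum (mapAlgHom (evalJet g)).toRingHom universalJet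
      (Finset.univ : Finset (Fin (m + 1)))).trans ?_
    congr 1
    exact funext fun c => funext fun l => mapAlgHom_universalJet g c l
  rw [h3] at h1
  rw [h1, coeff_smul, h2, smul_eq_mul, inv_mul_cancel_left₀ (by positivity)]

/-- Evaluation of the jet variables at `g` and of the polynomial variable at `1`. -/
def evalPolyJet (g : Colour → ℕ → Multiset (Fin d) → ℝ) : Polynomial (JetRing d) →ₐ[ℝ] ℝ :=
  (evalJet g).comp evalOne

theorem mapAlgHom_polyJet_universalJet (g : Colour → ℕ → Multiset (Fin d) → ℝ) (c : Colour)
    (l : Multiset (Fin d)) :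
    mapAlgHom (evalPolyJet g) (polyJet universalJet c l) = positivePart fun n => g c n l := by
  rw [← mapAlgHom_universalJet g]
  ext n
  rw [mapAlgHom_apply, mapAlgHom_apply, coeff_map, coeff_map, polyJet, mapAlgHom_apply, coeff_map]
  simp [evalPolyJet, evalOne, polyC]

theorem mapAlgHom_scale (g : Colour → ℕ → Multiset (Fin d) → ℝ) :
    mapAlgHom (evalPolyJet g) scale = 1 := by
  ext n
  rw [mapAlgHom_apply, scale, coeff_map, coeff_C, coeff_one]
  split_ifs <;> simp [evalPolyJet, evalOne]

/-- The padding by `n` lets the sum be split at `n` whatever the degree is. -/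
theorem evalOne_eq_sum {A : Type*} [CommRing A] [Algebra ℝ A] (p : Polynomial A) (n : ℕ) :
    evalOne p = ∑ m ∈ Finset.range (n + (p.natDegree + 1)), p.coeff m := by
  change Polynomial.aeval 1 p = _
  rw [Polynomial.coe_aeval_eq_eval, Polynomial.eval_eq_sum_range' (n := n + (p.natDegree + 1))
    (by omega)]
  simp

/-- The tree expansion of the critical value of `F(ξ) + G(π) - ξ π`. -/
theorem coeff_critValue (g : Colour → ℕ → Multiset (Fin d) → ℝ)
    {Y : Colour × Fin d → ℝ⟦X⟧}
    (hY : Y = gradMap (fun c l => positivePart fun n => g c n l) 1 Y) (n : ℕ) :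
    coeff n (critValue (fun c l => positivePart fun n => g c n l) 1 Y) =
      ∑ k ∈ Finset.Icc 1 n, ((k ! : ℕ) : ℝ)⁻¹ *
        coeff n (treeSum (fun c l => positivePart fun n => g c n l)
          (Finset.univ : Finset (Fin k))) := by
  obtain ⟨y, hy, -⟩ := existsUnique_gradMap (X_dvd_polyJet (X_dvd_universalJet (d := d))) scale
  -- The universal solution specialises to a solution of the given system, hence to `Y` by
  -- uniqueness.
  have hyY : (fun k => mapAlgHom (evalPolyJet g) (y k)) = Y := by
    refine (existsUnique_gradMap (fun c l => X_dvd_positivePart fun n => g c n l) 1).unique ?_ hY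
    conv_lhs => rw [hy]
    rw [map_gradMap, mapAlgHom_scale]
    simp_rw [mapAlgHom_polyJet_universalJet]
  have hW : mapAlgHom (evalPolyJet g) (critValue (polyJet universalJet) scale y) =
      critValue (fun c l => positivePart fun n => g c n l) 1 Y := by
    rw [map_critValue, mapAlgHom_scale, hyY]
    simp_rw [mapAlgHom_polyJet_universalJet]
  have hterm := evalJet_critValue g hy n
  rw [← hW]
  generalize critValue (polyJet universalJet) scale y = W at hterm
  -- The coefficient of `sᵐ` comes from trees with `m + 1` vertices, hence is divisible by `X ^ (m +
  -- 1)`.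
  have hzero : ∀ m, n ≤ m → evalJet g ((coeff n W).coeff m) = 0 := by
    intro m hm
    have := pow_card_dvd_treeSum (fun (c : Colour) (l : Multiset (Fin d)) =>
      X_dvd_positivePart fun n => g c n l) (Finset.univ : Finset (Fin (m + 1)))
    rw [Finset.card_univ, Fintype.card_fin] at this
    rw [hterm, X_pow_dvd_iff.1 this n (by omega), mul_zero]
  have hsum : coeff n (mapAlgHom (evalPolyJet g) W) =
      ∑ m ∈ Finset.range n, evalJet g ((coeff n W).coeff m) := by
    have h1 : coeff n (mapAlgHom (evalPolyJet g) W) = evalJet g (evalOne (coeff n W)) := by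
      rw [mapAlgHom_apply, coeff_map]
      rfl
    rw [h1, evalOne_eq_sum _ n, map_sum, Finset.sum_range_add, add_eq_left]
    exact Finset.sum_eq_zero fun m _ => hzero _ (by omega)
  rw [hsum, Finset.sum_congr rfl fun m _ => hterm m, Finset.range_eq_Ico,
    Finset.sum_Ico_add' (fun k => ((k ! : ℕ) : ℝ)⁻¹ *
        coeff n (treeSum (fun c l => positivePart fun n => g c n l)
          (Finset.univ : Finset (Fin k)))) 0 n 1]
  rfl

end UniversalJets

/-! ### From tree sums to sums over `BipartiteTree`. -/

section BipartiteTrees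

variable {k : ℕ} {ι : Type*}

/-- The labelling of the pairs of vertices given by a labelling of the edges. -/
def extendLabel (t : BipartiteTree k) (β : t.graph.edgeSet → ι) : Sym2 (Fin k) → Option ι :=
  open Classical in fun e => if h : e ∈ t.graph.edgeSet then some (β ⟨e, h⟩) else none

theorem extendLabel_of_mem {t : BipartiteTree k} {β : t.graph.edgeSet → ι} {e : Sym2 (Fin k)}
    (h : e ∈ t.graph.edgeSet) : extendLabel t β e = some (β ⟨e, h⟩) := dif_pos h

theorem extendLabel_ne_none {t : BipartiteTree k} {β : t.graph.edgeSet → ι} {e : Sym2 (Fin k)} :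
    extendLabel t β e ≠ none ↔ e ∈ t.graph.edgeSet := by
  unfold extendLabel
  split_ifs with h <;> simp [h]

theorem labelGraph_extendLabel (t : BipartiteTree k) (β : t.graph.edgeSet → ι) :
    labelGraph (extendLabel t β) = t.graph := by
  ext v w
  rw [labelGraph_adj, extendLabel_ne_none, SimpleGraph.mem_edgeSet]
  exact ⟨fun h => h.1, fun h => ⟨h, h.ne⟩⟩

theorem isLabelledTree_extendLabel (t : BipartiteTree k) (β : t.graph.edgeSet → ι) :
    IsLabelledTree Finset.univ (extendLabel t β, t.colour) where
  isTreeOn := by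
    rw [labelGraph_extendLabel, isTreeOn_univ]
    exact t.2.1
  diag v := by
    by_contra h
    have := extendLabel_ne_none.1 h
    rw [SimpleGraph.mem_edgeSet] at this
    exact this.ne rfl
  proper v w h := by
    rw [labelGraph_extendLabel] at h
    exact t.2.2 v w h
  outside v hv := absurd (Finset.mem_univ v) hv

theorem labelsAt_extendLabel (t : BipartiteTree k) (β : t.graph.edgeSet → ι) (v : Fin k) :
    labelsAt (extendLabel t β) v = ((t.edgesAt v).map β : List ι) := by
  classical
  have h1 : labelsAt (extendLabel t β) v =
      ∑ w with t.graph.Adj v w, labelMultiset (extendLabel t β s(v, w)) := by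
    rw [labelsAt, Finset.sum_filter]
    refine Finset.sum_congr rfl fun w _ => ?_
    split_ifs with h
    · rfl
    · have : extendLabel t β s(v, w) = none := by
        by_contra h'
        exact h (extendLabel_ne_none.1 h')
      rw [this, labelMultiset]
  have h2 : (((t.edgesAt v).map β : List ι) : Multiset ι) =
      ∑ e ∈ Finset.univ.filter fun e : t.graph.edgeSet => v ∈ (e : Sym2 (Fin k)), {β e} := by
    rw [← Multiset.map_coe, BipartiteTree.edgesAt, Finset.coe_toList, Finset.sum_eq_multiset_sum,
      ← Multiset.sum_map_singleton (Multiset.map β _), Multiset.map_map]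
    congr!
  rw [h1, h2]
  refine Finset.sum_bij (fun w hw => ⟨s(v, w), (Finset.mem_filter.1 hw).2⟩) ?_ ?_ ?_ ?_
  · intro w hw
    simp
  · intro w hw w' hw' h
    exact Sym2.congr_right.1 (Subtype.ext_iff.1 h)
  · rintro ⟨e, he⟩ hv
    obtain ⟨w, rfl⟩ := (Finset.mem_filter.1 hv).2
    exact ⟨w, Finset.mem_filter.2 ⟨Finset.mem_univ _, he⟩, rfl⟩
  · intro w hw
    rw [extendLabel_of_mem (Finset.mem_filter.1 hw).2, labelMultiset]

theorem treeSum_univ [Fintype ι] {R : Type*} [CommRing R] (J : Colour → Multiset ι → R) :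
    treeSum J (Finset.univ : Finset (Fin k)) =
      ∑ t : BipartiteTree k, ∑ β : t.graph.edgeSet → ι,
        ∏ v, J (t.colour v) ((t.edgesAt v).map β : List ι) := by
  classical
  rw [treeSum, ← Fintype.sum_sigma' fun (t : BipartiteTree k) (β : t.graph.edgeSet → ι) =>
    ∏ v, J (t.colour v) ((t.edgesAt v).map β : List ι)]
  symm
  refine Finset.sum_bij (fun x _ => (extendLabel x.1 x.2, x.1.colour)) ?_ ?_ ?_ ?_
  · exact fun x _ => Finset.mem_filter.2 ⟨Finset.mem_univ _, isLabelledTree_extendLabel x.1 x.2⟩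
  · rintro ⟨t, β⟩ - ⟨t', β'⟩ - h
    obtain ⟨h1, h2⟩ := Prod.ext_iff.1 h
    have ht : t = t' := Subtype.ext (Prod.ext (by
      have := congr_arg labelGraph h1
      rwa [labelGraph_extendLabel, labelGraph_extendLabel] at this) h2)
    subst ht
    congr 1
    funext ⟨e, he⟩
    have : extendLabel t β e = extendLabel t β' e := congr_fun h1 e
    rw [extendLabel_of_mem he, extendLabel_of_mem he] at this
    exact Option.some.inj this
  · intro p hp
    have hp := (Finset.mem_filter.1 hp).2
    let t : BipartiteTree k := ⟨(labelGraph p.1, p.2), (isTreeOn_univ _).1 hp.isTreeOn, hp.proper⟩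
    have ht : ∀ e, e ∈ t.graph.edgeSet ↔ p.1 e ≠ none := by
      intro e
      induction e with | _ v w
      exact hp.adj_iff
    refine ⟨⟨t, fun e => (p.1 e).get (Option.isSome_iff_ne_none.2 ((ht e).1 e.2))⟩,
      Finset.mem_univ _, Prod.ext (funext fun e => ?_) rfl⟩
    by_cases he : e ∈ t.graph.edgeSet
    · simp only [extendLabel_of_mem he, Option.some_get]
    · have h1 : p.1 e = none := not_not.1 fun h => he ((ht e).2 h)
      rw [h1]
      by_contra h
      exact he (extendLabel_ne_none.1 h)
  · rintro ⟨t, β⟩ -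
    simp only [treeWeight, labelsAt_extendLabel, Pi.zero_apply, zero_add]

/-- A vanishing part `ν v = 0` kills the product, which leaves the compositions into positive parts.
-/
theorem coeff_prod_positivePart (g : Fin k → ℕ → ℝ) (n : ℕ) :
    PowerSeries.coeff n (∏ v, positivePart (g v)) = ∑ ν ∈ compositions k n, ∏ v, g v (ν v) := by
  rw [PowerSeries.coeff_prod, compositions, Finset.sum_filter]
  refine Finset.sum_bij' (fun l _ => ⇑l) (fun ν _ => Finsupp.equivFunOnFinite.symm ν) ?_ ?_ ?_ ?_ ?_
  · intro l hl
    simpa using hl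
  · intro l hl
    simpa using hl
  · simp
  · simp
  · intro l hl
    simp only [coeff_positivePart]
    split_ifs with h
    · exact Finset.prod_congr rfl fun v _ => if_neg (by have := h v; omega)
    · push Not at h
      obtain ⟨v, hv⟩ := h
      exact Finset.prod_eq_zero (Finset.mem_univ v) (if_pos (by omega))

theorem coeff_treeSum_univ {d : ℕ} (g : Colour → ℕ → Multiset (Fin d) → ℝ) (n : ℕ) :
    PowerSeries.coeff n (treeSum (fun c l => positivePart fun n => g c n l)
      (Finset.univ : Finset (Fin k))) =
      ∑ t : BipartiteTree k, ∑ ν ∈ compositions k n, ∑ β : t.graph.edgeSet → Fin d,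
        ∏ v, g (t.colour v) (ν v) ((t.edgesAt v).map β : List (Fin d)) := by
  rw [treeSum_univ, map_sum]
  refine Finset.sum_congr rfl fun t _ => ?_
  rw [map_sum, Finset.sum_comm]
  exact Finset.sum_congr rfl fun β _ => coeff_prod_positivePart _ n

end BipartiteTrees

/-! ### Iterated partial derivatives as symmetric jets. -/

section PartialDerivatives

variable {d : ℕ}

theorem contDiff_partialDeriv {f : B₂ d → ℝ} (hf : ContDiff ℝ ∞ f) (c : Fin 3 × Fin d) :
    ContDiff ℝ ∞ (partialDeriv c f) :=
  (hf.fderiv_right (m := ∞) (by norm_num)).clm_apply contDiff_const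

theorem contDiff_mixedPartial {f : B₂ d → ℝ} (hf : ContDiff ℝ ∞ f) (l : List (Fin 3 × Fin d)) :
    ContDiff ℝ ∞ (mixedPartial l f) := by
  induction l with
  | nil => exact hf
  | cons c l ih => exact contDiff_partialDeriv ih c

theorem partialDeriv_comm {f : B₂ d → ℝ} (hf : ContDiff ℝ ∞ f) (c c' : Fin 3 × Fin d) :
    partialDeriv c (partialDeriv c' f) = partialDeriv c' (partialDeriv c f) := by
  funext y
  have hd : DifferentiableAt ℝ (fderiv ℝ f) y :=
    ((hf.fderiv_right (m := ∞) (by norm_num)).differentiable (by simp)) y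
  have h : ∀ v w : B₂ d, fderiv ℝ (fun z => fderiv ℝ f z v) y w =
      fderiv ℝ (fderiv ℝ f) y w v := by
    intro v w
    rw [fderiv_clm_apply hd (differentiableAt_const v)]
    simp
  unfold partialDeriv
  rw [h, h]
  have h2 : ContDiff ℝ 2 f := hf.of_le (WithTop.coe_le_coe.2 le_top)
  exact (h2.contDiffAt.isSymmSndFDerivAt (by simp)).eq _ _

theorem mixedPartial_perm {f : B₂ d → ℝ} (hf : ContDiff ℝ ∞ f) {l l' : List (Fin 3 × Fin d)}
    (h : l.Perm l') : mixedPartial l f = mixedPartial l' f := by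
  induction h with
  | nil => rfl
  | cons c _ ih => exact congr_arg (partialDeriv c) ih
  | swap c c' l => exact partialDeriv_comm (contDiff_mixedPartial hf l) _ _
  | trans _ _ ih ih' => exact ih.trans ih'

theorem mixedPartial_partialDeriv {f : B₂ d → ℝ} (hf : ContDiff ℝ ∞ f) (l : List (Fin 3 × Fin d))
    (c : Fin 3 × Fin d) : mixedPartial l (partialDeriv c f) = mixedPartial (c :: l) f := by
  rw [mixedPartial_perm hf (List.perm_append_singleton c l).symm]
  simp [mixedPartial]

/-- The derivatives of `f` at `P` with respect to the coordinates of slot `s`. -/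
def slotJet (s : Fin 3) (P : B₂ d) (f : B₂ d → ℝ) (l : Multiset (Fin d)) : ℝ :=
  mixedPartial (l.toList.map fun i => (s, i)) f P

theorem slotJet_coe {f : B₂ d → ℝ} (hf : ContDiff ℝ ∞ f) (s : Fin 3) (P : B₂ d)
    (l : List (Fin d)) :
    slotJet s P f (l : Multiset (Fin d)) = mixedPartial (l.map fun i => (s, i)) f P := by
  rw [slotJet, mixedPartial_perm hf (List.Perm.map _ (Multiset.coe_eq_coe.1 (Multiset.coe_toList _)))]

theorem slotJet_zero (s : Fin 3) (P : B₂ d) (f : B₂ d → ℝ) : slotJet s P f 0 = f P := by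
  simp [slotJet, mixedPartial]

theorem slotJet_cons {f : B₂ d → ℝ} (hf : ContDiff ℝ ∞ f) (s : Fin 3) (P : B₂ d) (i : Fin d)
    (l : Multiset (Fin d)) :
    slotJet s P f (i ::ₘ l) = slotJet s P (partialDeriv (s, i) f) l := by
  obtain ⟨l, rfl⟩ := Quot.exists_rep l
  change slotJet s P f ((i :: l : List (Fin d)) : Multiset (Fin d)) = slotJet s P _ (l : Multiset _)
  rw [slotJet_coe hf, slotJet_coe (contDiff_partialDeriv hf _), mixedPartial_partialDeriv hf,
    List.map_cons]

theorem partialDeriv_eq_of_line {f : B₂ d → ℝ} (hf : ContDiff ℝ ∞ f) {c : Fin 3 × Fin d}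
    {y : B₂ d} {L : ℝ}
    (h : ∀ t : ℝ, f (y + t • (Pi.single c.1 (Pi.single c.2 1) : B₂ d)) = f y + t * L) :
    partialDeriv c f y = L := by
  have h1 := ((hf.differentiable (by simp)) y).lineDeriv_eq_fderiv
    (v := (Pi.single c.1 (Pi.single c.2 1) : B₂ d))
  rw [partialDeriv, ← h1, lineDeriv]
  simp_rw [h]
  simp

end PartialDerivatives

/-! ### Taylor substitution when only one slot varies. -/

section Substitution

variable {d : ℕ}

theorem taylorTerm_eq_sum {ι A : Type*} [Fintype ι] [CommRing A] (y : ι → A) (m : ℕ)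
    (J : Multiset ι → A) :
    taylorTerm y m J = ∑ γ : Fin m → ι, J (List.ofFn γ : List ι) * ∏ j, y (γ j) := by
  induction m generalizing J with
  | zero => simp [taylorTerm]
  | succ m ih =>
    rw [taylorTerm_succ, ← (Fin.consEquiv fun _ => ι).sum_comp, Fintype.sum_prod_type]
    refine Finset.sum_congr rfl fun i _ => ?_
    rw [ih, Finset.mul_sum]
    refine Finset.sum_congr rfl fun γ _ => ?_
    have h : List.ofFn (Fin.consEquiv (fun _ => ι) (i, γ)) = i :: List.ofFn γ := by
      rw [List.ofFn_succ]
      rfl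
    rw [h, Fin.prod_univ_succ, Multiset.cons_coe]
    exact mul_left_comm _ _ _

/-- The formal point whose slot `s` is `v` and whose other slots are those of `P`. -/
def slotPoint (s : Fin 3) (P : B₂ d) (v : Fin d → ℝ⟦X⟧) : Fin 3 → Fin d → ℝ⟦X⟧ :=
  Function.update (fun s => const (P s)) s v

theorem slotPoint_self (s : Fin 3) (P : B₂ d) (v : Fin d → ℝ⟦X⟧) : slotPoint s P v s = v :=
  Function.update_self _ _ _

theorem slotPoint_of_ne {s s' : Fin 3} (h : s' ≠ s) (P : B₂ d) (v : Fin d → ℝ⟦X⟧) :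
    slotPoint s P v s' = const (P s') := Function.update_of_ne h _ _

theorem constTerm_slotPoint_of_ne {s s' : Fin 3} (h : s' ≠ s) (P : B₂ d) (v : Fin d → ℝ⟦X⟧) :
    constTerm (slotPoint s P v) s' = P s' := by
  funext i
  simp [constTerm, slotPoint_of_ne h, const]

theorem constTerm_slotPoint {s : Fin 3} {P : B₂ d} {z : Fin d → ℝ⟦X⟧} (hz : ∀ i, X ∣ z i) :
    constTerm (slotPoint s P fun i => PowerSeries.C (P s i) + z i) = P := by
  funext s'
  by_cases h : s' = s
  · subst h
    funext i
    rw [constTerm, slotPoint_self, map_add, X_dvd_iff.1 (hz i)]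
    simp
  · exact constTerm_slotPoint_of_ne h _ _

theorem seriesSubst_slotPoint {S : ℕ → B₂ d → ℝ} (hS : ∀ n, ContDiff ℝ ∞ (S n)) (s : Fin 3)
    (P : B₂ d) {z : Fin d → ℝ⟦X⟧} (hz : ∀ i, X ∣ z i) :
    seriesSubst S (slotPoint s P fun i => PowerSeries.C (P s i) + z i) =
      formalTaylor (fun l => PowerSeries.mk fun n => slotJet s P (S n) l) z := by
  have h1 : ∀ f : B₂ d → ℝ, ContDiff ℝ ∞ f → ∀ m n : ℕ, ∑ β : Fin m → Fin 3 × Fin d,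
      mixedPartial (List.ofFn β) f P * coeff n (∏ j,
        ((slotPoint s P fun i => PowerSeries.C (P s i) + z i) (β j).1 (β j).2 -
          PowerSeries.C (P (β j).1 (β j).2))) =
      ∑ γ : Fin m → Fin d, slotJet s P f (List.ofFn γ : List (Fin d)) *
        coeff n (∏ j, z (γ j)) := by
    intro f hf m n
    symm
    -- A multi-index leaving the slot `s` meets a zero increment, so only multi-indices within this
    -- slot count.
    refine Fintype.sum_of_injective (fun (γ : Fin m → Fin d) j => (s, γ j)) ?_ _ _ ?_ ?_
    · intro γ γ' h
      funext j
      exact (Prod.ext_iff.1 (congr_fun h j)).2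
    · intro β hβ
      have : ∃ j, (β j).1 ≠ s := by
        by_contra! h
        exact hβ ⟨fun j => (β j).2, funext fun j => Prod.ext (h j).symm rfl⟩
      obtain ⟨j, hj⟩ := this
      rw [Finset.prod_eq_zero (Finset.mem_univ j), map_zero, mul_zero]
      rw [slotPoint_of_ne hj, const, sub_self]
    · intro γ
      rw [slotJet_coe hf, List.map_ofFn]
      simp only [slotPoint_self, add_sub_cancel_left]
      rfl
  ext n
  rw [seriesSubst, coeff_mk, formalTaylor, coeff_mk, taylorPoly, map_sum]
  have h2 : ∀ m, coeff n (((m ! : ℕ) : ℝ)⁻¹ • taylorTerm z m fun l =>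
      PowerSeries.mk fun n => slotJet s P (S n) l) =
      ∑ ij ∈ Finset.HasAntidiagonal.antidiagonal n, ((m ! : ℕ) : ℝ)⁻¹ *
        ∑ γ : Fin m → Fin d, slotJet s P (S ij.1) (List.ofFn γ : List (Fin d)) *
          coeff ij.2 (∏ j, z (γ j)) := by
    intro m
    rw [taylorTerm_eq_sum, coeff_smul, map_sum, smul_eq_mul, ← Finset.mul_sum, Finset.sum_comm]
    congr 1
    refine Finset.sum_congr rfl fun γ _ => ?_
    rw [coeff_mul]
    simp only [coeff_mk]
  simp_rw [h2]
  rw [Finset.sum_comm]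
  refine Finset.sum_congr rfl fun ij hij => ?_
  rw [taylorSubst, coeff_mk, constTerm_slotPoint hz]
  simp_rw [h1 _ (hS _)]
  have hle := Finset.HasAntidiagonal.mem_antidiagonal.1 hij
  -- The two truncations differ by terms of degree `m` above the order considered; these vanish
  -- because a product of `m` increments is divisible by `X ^ m`.
  refine Finset.sum_subset (Finset.range_mono (by omega)) fun m _ hm => ?_
  rw [Finset.mem_range, not_lt] at hm
  refine mul_eq_zero_of_right _ (Finset.sum_eq_zero fun γ _ => mul_eq_zero_of_right _ ?_)
  have : (X : ℝ⟦X⟧) ^ m ∣ ∏ j, z (γ j) := by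
    simpa using Finset.prod_dvd_prod_of_dvd (s := Finset.univ) (fun _ : Fin m => (X : ℝ⟦X⟧))
      (fun j => z (γ j)) fun j _ => hz _
  exact X_pow_dvd_iff.1 this _ (by omega)

theorem coeff_zero_seriesSubst (S : ℕ → B₂ d → ℝ) (y : Fin 3 → Fin d → ℝ⟦X⟧) :
    coeff 0 (seriesSubst S y) = S 0 (constTerm y) := by
  simp [seriesSubst, taylorSubst, mixedPartial]

end Substitution

/-! ### Separating the contribution of `S₀`. -/

section Bilinear

variable {d : ℕ} {S : ℕ → B₂ d → ℝ}

theorem contDiff_dotProduct : ContDiff ℝ ∞ fun y : B₂ d => y 2 ⬝ᵥ (y 0 + y 1) := by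
  simp only [dotProduct, Pi.add_apply]
  fun_prop

/-- The gradient of `x ⬝ᵥ (p₁ + p₂)` with respect to slot `s`. -/
def bilinearGrad (s : Fin 3) (y : B₂ d) : Fin d → ℝ :=
  if s = 2 then y 0 + y 1 else y 2

theorem partialDeriv_dotProduct (s : Fin 3) (i : Fin d) :
    partialDeriv (s, i) (fun y : B₂ d => y 2 ⬝ᵥ (y 0 + y 1)) = fun y => bilinearGrad s y i := by
  funext y
  refine partialDeriv_eq_of_line contDiff_dotProduct fun t => ?_
  fin_cases s
  · simp [bilinearGrad, dotProduct_add, add_right_comm]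
  · simp [bilinearGrad, dotProduct_add, add_assoc]
  · simp [bilinearGrad, add_dotProduct]
    ring

theorem contDiff_bilinearGrad (s : Fin 3) (i : Fin d) :
    ContDiff ℝ ∞ fun y : B₂ d => bilinearGrad s y i := by
  rw [← partialDeriv_dotProduct]
  exact contDiff_partialDeriv contDiff_dotProduct _

theorem partialDeriv_bilinearGrad (s : Fin 3) (i j : Fin d) :
    partialDeriv (s, j) (fun y : B₂ d => bilinearGrad s y i) = fun _ => 0 := by
  funext y
  refine partialDeriv_eq_of_line (contDiff_bilinearGrad s i) fun t => ?_
  fin_cases s <;> simp [bilinearGrad]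

theorem slotJet_zero_fun (s : Fin 3) (P : B₂ d) (l : Multiset (Fin d)) :
    slotJet s P (fun _ => 0) l = 0 := by
  have h : ∀ l : List (Fin 3 × Fin d), mixedPartial l (fun _ : B₂ d => (0 : ℝ)) = fun _ => 0 := by
    intro l
    induction l with
    | nil => rfl
    | cons c l ih =>
      change partialDeriv c (mixedPartial l _) = _
      rw [ih]
      funext y
      simp [partialDeriv]
  rw [slotJet, h]

theorem formalTaylor_eq_of_zero {ι A : Type*} [Fintype ι] [CommRing A] [Algebra ℝ A]
    {J : Multiset ι → A⟦X⟧} {z : ι → A⟦X⟧} (hz : ∀ i, X ∣ z i)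
    (hJ : ∀ i j l, J (i ::ₘ j ::ₘ l) = 0) :
    formalTaylor J z = J 0 + ∑ i, z i * J {i} := by
  have h1 : ∀ m, taylorTerm z (m + 2) J = 0 := by
    intro m
    simp only [taylorTerm_succ, hJ, taylorTerm_zero_jet, mul_zero, Finset.sum_const_zero]
  refine eq_of_forall_X_pow_dvd_sub fun N => ?_
  have h2 := (pow_dvd_pow (X : A⟦X⟧) (Nat.le_add_right N 2)).trans
    (X_pow_dvd_formalTaylor_sub hz (N + 2) J)
  have h3 : taylorPoly (N + 2) J z = J 0 + ∑ i, z i * J {i} := by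
    rw [taylorPoly, Finset.sum_range_succ', Finset.sum_range_succ',
      Finset.sum_eq_zero fun m _ => by rw [h1, smul_zero]]
    simp [taylorTerm, add_comm]
  rwa [h3] at h2

theorem mk_eq_C_add_positivePart (g : ℕ → ℝ) :
    PowerSeries.mk g = PowerSeries.C (g 0) + positivePart g := by
  ext n
  rw [map_add, coeff_mk, coeff_C, coeff_positivePart]
  split_ifs with h <;> simp [h]

variable (h0 : S 0 = fun y => y 2 ⬝ᵥ (y 0 + y 1)) (hS : ∀ n, ContDiff ℝ ∞ (S n))

include h0 hS

/-- `S₀` is affine in each slot, so its Taylor series stops after the linear term. -/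
theorem seriesSubst_eq (s : Fin 3) (P : B₂ d) {z : Fin d → ℝ⟦X⟧} (hz : ∀ i, X ∣ z i) :
    seriesSubst S (slotPoint s P fun i => PowerSeries.C (P s i) + z i) =
      PowerSeries.C (P 2 ⬝ᵥ (P 0 + P 1)) + ∑ i, z i * PowerSeries.C (bilinearGrad s P i) +
        formalTaylor (fun l => positivePart fun n => slotJet s P (S n) l) z := by
  rw [seriesSubst_slotPoint hS s P hz]
  simp_rw [mk_eq_C_add_positivePart]
  rw [formalTaylor_add, formalTaylor_eq_of_zero hz]
  · simp only [slotJet_zero, ← Multiset.cons_zero, slotJet_cons (hS 0)]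
    simp only [h0, partialDeriv_dotProduct]
  · intro i j l
    rw [slotJet_cons (hS 0), slotJet_cons (contDiff_partialDeriv (hS 0) _), h0,
      partialDeriv_dotProduct, partialDeriv_bilinearGrad, slotJet_zero_fun, map_zero]

theorem seriesGrad_eq (s : Fin 3) (P : B₂ d) {z : Fin d → ℝ⟦X⟧} (hz : ∀ i, X ∣ z i) (i : Fin d) :
    seriesGrad s S (slotPoint s P fun i => PowerSeries.C (P s i) + z i) i =
      PowerSeries.C (bilinearGrad s P i) +
        formalTaylor (fun l => positivePart fun n => slotJet s P (S n) (i ::ₘ l)) z := by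
  rw [seriesGrad, seriesSubst_slotPoint (fun n => contDiff_partialDeriv (hS n) _) s P hz]
  simp_rw [mk_eq_C_add_positivePart]
  rw [formalTaylor_add, formalTaylor_eq_of_zero hz]
  · have h1 : partialDeriv (s, i) (S 0) = fun y => bilinearGrad s y i := by
      rw [h0, partialDeriv_dotProduct]
    simp only [slotJet_zero, ← Multiset.cons_zero, h1, slotJet_cons (contDiff_bilinearGrad s i),
      partialDeriv_bilinearGrad, slotJet_cons (hS _)]
    simp
  · intro j k l
    rw [slotJet_cons (contDiff_partialDeriv (hS 0) _), h0,
      partialDeriv_dotProduct, partialDeriv_bilinearGrad, slotJet_zero_fun, map_zero]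

omit hS in
theorem coeff_zero_seriesGrad (s : Fin 3) (y : Fin 3 → Fin d → ℝ⟦X⟧) (i : Fin d) :
    coeff 0 (seriesGrad s S y i) = bilinearGrad s (constTerm y) i := by
  rw [seriesGrad, coeff_zero_seriesSubst, h0, partialDeriv_dotProduct]

end Bilinear

/-! ### Each side of the equation as a critical value. -/

section Sides

variable {d : ℕ} {S : ℕ → B₂ d → ℝ}

/-- The jets of `S` at the base points of the two colours. -/
def sideJet (S : ℕ → B₂ d → ℝ) (s : Colour → Fin 3) (P : Colour → B₂ d) (c : Colour)
    (l : Multiset (Fin d)) : ℝ⟦X⟧ :=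
  positivePart fun n => slotJet (s c) (P c) (S n) l

theorem X_dvd_sideJet (s : Colour → Fin 3) (P : Colour → B₂ d) (c : Colour)
    (l : Multiset (Fin d)) : X ∣ sideJet S s P c l := X_dvd_positivePart _

theorem C_add_sub_cancel {a : ℝ} {f : ℝ⟦X⟧} (h : coeff 0 f = a) : X ∣ f - PowerSeries.C a := by
  rw [X_dvd_iff, map_sub, ← coeff_zero_eq_constantCoeff_apply, h]
  simp

variable (h0 : S 0 = fun y => y 2 ⬝ᵥ (y 0 + y 1)) (hS : ∀ n, ContDiff ℝ ∞ (S n))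
  {s : Colour → Fin 3} {P : Colour → B₂ d} {x q : Fin d → ℝ}
  (hsw : s .white = 2) (hsb : s .black ≠ 2)
  (hwx : P .white 2 = x) (hwq : P .white 0 + P .white 1 = q)
  (hbx : P .black 2 = x) (hbq : P .black (s .black) = q)

include h0 hS hsw hsb hwx hwq hbx hbq

/-- The implicit equations of one side as a critical-point system. -/
theorem implicit_iff (xb pb : Fin d → ℝ⟦X⟧) :
    (xb = seriesGrad (s .black) S (slotPoint (s .black) (P .black) pb) ∧
      pb = seriesGrad 2 S (slotPoint 2 (P .white) xb)) ↔
    ∃ Y, Y = gradMap (sideJet S s P) 1 Y ∧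
      xb = (fun i => PowerSeries.C (x i) + Y (.black, i)) ∧
      pb = fun i => PowerSeries.C (q i) + Y (.white, i) := by
  have hgw : bilinearGrad 2 (P .white) = q := by rw [bilinearGrad, if_pos rfl, hwq]
  have hgb : bilinearGrad (s .black) (P .black) = x := by rw [bilinearGrad, if_neg hsb, hbx]
  -- with increments `ξ` and `π` the gradients are the components of `gradMap`
  have key : ∀ Y : Colour × Fin d → ℝ⟦X⟧, (∀ k, X ∣ Y k) →
      (∀ i, seriesGrad (s .black) S (slotPoint (s .black) (P .black)
        fun i => PowerSeries.C (q i) + Y (.white, i)) i =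
          PowerSeries.C (x i) + gradMap (sideJet S s P) 1 Y (.black, i)) ∧
      ∀ i, seriesGrad 2 S (slotPoint 2 (P .white) fun i => PowerSeries.C (x i) + Y (.black, i)) i =
          PowerSeries.C (q i) + gradMap (sideJet S s P) 1 Y (.white, i) := by
    intro Y hY
    refine ⟨fun i => ?_, fun i => ?_⟩
    · have := seriesGrad_eq h0 hS (s .black) (P .black) (fun i => hY (.white, i)) i
      rw [hbq, hgb] at this
      rw [this]
      simp only [gradMap, sideJet, Colour.other, one_mul]
    · have := seriesGrad_eq h0 hS 2 (P .white) (fun i => hY (.black, i)) i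
      rw [hwx, hgw] at this
      rw [this]
      simp only [gradMap, sideJet, Colour.other, one_mul, hsw]
  constructor
  · rintro ⟨hx, hp⟩
    -- The constant term of a gradient sees only `S₀`, so the constant terms of any solution are
    -- forced to be `x` and `q`, and the increments have positive order.
    have hx0 : ∀ i, coeff 0 (xb i) = x i := by
      intro i
      rw [hx, coeff_zero_seriesGrad h0, bilinearGrad, if_neg hsb,
        constTerm_slotPoint_of_ne hsb.symm, hbx]
    have hp0 : ∀ i, coeff 0 (pb i) = q i := by
      intro i
      rw [hp, coeff_zero_seriesGrad h0, bilinearGrad, if_pos rfl,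
        constTerm_slotPoint_of_ne (by decide), constTerm_slotPoint_of_ne (by decide), hwq]
    let Y : Colour × Fin d → ℝ⟦X⟧ := fun k => match k with
      | (.white, i) => pb i - PowerSeries.C (q i)
      | (.black, i) => xb i - PowerSeries.C (x i)
    have hY : ∀ k, X ∣ Y k := by
      rintro ⟨c, i⟩
      cases c
      · exact C_add_sub_cancel (hp0 i)
      · exact C_add_sub_cancel (hx0 i)
    have hpY : pb = fun i => PowerSeries.C (q i) + Y (.white, i) := by
      funext i
      simp [Y]
    have hxY : xb = fun i => PowerSeries.C (x i) + Y (.black, i) := by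
      funext i
      simp [Y]
    refine ⟨Y, ?_, hxY, hpY⟩
    obtain ⟨k1, k2⟩ := key Y hY
    rw [← hpY, ← hx] at k1
    rw [← hxY, ← hp] at k2
    funext ⟨c, i⟩
    cases c
    · have := k2 i
      rwa [hpY, add_right_inj] at this
    · have := k1 i
      rwa [hxY, add_right_inj] at this
  · rintro ⟨Y, hY, rfl, rfl⟩
    obtain ⟨k1, k2⟩ := key Y (X_dvd_of_eq_gradMap (X_dvd_sideJet s P) hY)
    refine ⟨funext fun i => ?_, funext fun i => ?_⟩
    · rw [k1, ← hY]
    · rw [k2, ← hY]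

/-- Expanding `(x + ξ) (q + π)`, the terms `x q`, `ξ q` and `π x` cancel against the values and
linear terms of `S₀`; only `ξ π` and one constant survive. -/
theorem side_value {Y : Colour × Fin d → ℝ⟦X⟧} (hY : Y = gradMap (sideJet S s P) 1 Y)
    {xb pb : Fin d → ℝ⟦X⟧} (hxb : xb = fun i => PowerSeries.C (x i) + Y (.black, i))
    (hpb : pb = fun i => PowerSeries.C (q i) + Y (.white, i)) :
    seriesSubst S (slotPoint 2 (P .white) xb) +
        seriesSubst S (slotPoint (s .black) (P .black) pb) - xb ⬝ᵥ pb =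
      PowerSeries.C (x ⬝ᵥ (P .black 0 + P .black 1)) + critValue (sideJet S s P) 1 Y := by
  have hX := X_dvd_of_eq_gradMap (X_dvd_sideJet s P) hY
  have hgw : bilinearGrad 2 (P .white) = q := by rw [bilinearGrad, if_pos rfl, hwq]
  have hgb : bilinearGrad (s .black) (P .black) = x := by rw [bilinearGrad, if_neg hsb, hbx]
  have h1 := seriesSubst_eq h0 hS 2 (P .white) (fun i => hX (.black, i))
  have h2 := seriesSubst_eq h0 hS (s .black) (P .black) (fun i => hX (.white, i))
  rw [hwx, hwq, hgw] at h1
  rw [hbq, hbx, hgb] at h2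
  have h3 : xb ⬝ᵥ pb = PowerSeries.C (x ⬝ᵥ q) + ∑ i, Y (.black, i) * PowerSeries.C (q i) +
      ∑ i, Y (.white, i) * PowerSeries.C (x i) + ∑ i, Y (.white, i) * Y (.black, i) := by
    rw [hxb, hpb]
    simp only [dotProduct, map_sum, map_mul, ← Finset.sum_add_distrib]
    exact Finset.sum_congr rfl fun i _ => by ring
  rw [h3, hxb, hpb, h1, h2, critValue, Colour.sum_eq]
  simp only [one_mul, Colour.other]
  unfold sideJet
  rw [hsw]
  ring

end Sides

/-! ### Comparison of the two sides. -/

section Main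

variable {d : ℕ} {S : ℕ → B₂ d → ℝ}

/-- The critical value of one side is the sum over the bipartite trees. -/
theorem coeff_critValue_sideJet (hS : ∀ n, ContDiff ℝ ∞ (S n)) (i : Side)
    (p₁ p₂ p₃ x : Fin d → ℝ) {Y : Colour × Fin d → ℝ⟦X⟧}
    (hY : Y = gradMap (sideJet S (slot i) (basePoint p₁ p₂ p₃ x i)) 1 Y) (n : ℕ) :
    coeff n (critValue (sideJet S (slot i) (basePoint p₁ p₂ p₃ x i)) 1 Y) =
      ∑ k ∈ Finset.Icc 1 n, ∑ t : BipartiteTree k, (1 / ((k ! : ℕ) : ℝ)) *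
        ∑ ν ∈ compositions k n, C i t (fun v => S (ν v)) p₁ p₂ p₃ x := by
  have h := coeff_critValue
    (fun c n l => slotJet (slot i c) (basePoint p₁ p₂ p₃ x i c) (S n) l) hY n
  refine h.trans (Finset.sum_congr rfl fun k _ => ?_)
  rw [coeff_treeSum_univ, Finset.mul_sum]
  refine Finset.sum_congr rfl fun t _ => ?_
  rw [one_div]
  congr 1
  refine Finset.sum_congr rfl fun ν _ => ?_
  rw [C]
  refine Finset.sum_congr rfl fun β _ => Finset.prod_congr rfl fun v _ => ?_
  rw [slotJet_coe (hS _), List.map_map]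
  rfl

theorem vec_eq_slotPoint_zero (v : Fin d → ℝ⟦X⟧) (a b c : Fin d → ℝ) :
    ![v, const b, const c] = slotPoint 0 ![a, b, c] v := by
  funext s
  fin_cases s <;> rfl

theorem vec_eq_slotPoint_one (v : Fin d → ℝ⟦X⟧) (a b c : Fin d → ℝ) :
    ![const a, v, const c] = slotPoint 1 ![a, b, c] v := by
  funext s
  fin_cases s <;> rfl

theorem vec_eq_slotPoint_two (v : Fin d → ℝ⟦X⟧) (a b c : Fin d → ℝ) :
    ![const a, const b, v] = slotPoint 2 ![a, b, c] v := by
  funext s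
  fin_cases s <;> rfl

/-- The critical system has exactly one solution on each side, so the existential over solutions can
be traded for a universal one. -/
theorem satisfies_iff (h0 : S 0 = fun y => y 2 ⬝ᵥ (y 0 + y 1)) (hS : ∀ n, ContDiff ℝ ∞ (S n)) :
    Satisfies S ↔ ∀ p₁ p₂ p₃ x : Fin d → ℝ, ∀ Y Z : Colour × Fin d → ℝ⟦X⟧,
      Y = gradMap (sideJet S (slot .first) (basePoint p₁ p₂ p₃ x .first)) 1 Y →
      Z = gradMap (sideJet S (slot .second) (basePoint p₁ p₂ p₃ x .second)) 1 Z →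
      critValue (sideJet S (slot .first) (basePoint p₁ p₂ p₃ x .first)) 1 Y =
        critValue (sideJet S (slot .second) (basePoint p₁ p₂ p₃ x .second)) 1 Z := by
  refine forall_congr' fun p₁ => forall_congr' fun p₂ => forall_congr' fun p₃ =>
    forall_congr' fun x => ?_
  have i1 := implicit_iff h0 hS (s := slot .first) (P := basePoint p₁ p₂ p₃ x .first) (x := x)
    (q := p₁ + p₂) rfl (by decide) rfl rfl rfl rfl
  have i2 := implicit_iff h0 hS (s := slot .second) (P := basePoint p₁ p₂ p₃ x .second) (x := x)
    (q := p₂ + p₃) rfl (by decide) rfl rfl rfl rfl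
  have v1 : ∀ Y hY xb pb hxb hpb, _ := fun Y hY xb pb hxb hpb =>
    side_value h0 hS (s := slot .first) (P := basePoint p₁ p₂ p₃ x .first) (x := x)
      (q := p₁ + p₂) rfl (by decide) rfl rfl rfl rfl (Y := Y) hY (xb := xb) (pb := pb) hxb hpb
  have v2 : ∀ Y hY xb pb hxb hpb, _ := fun Y hY xb pb hxb hpb =>
    side_value h0 hS (s := slot .second) (P := basePoint p₁ p₂ p₃ x .second) (x := x)
      (q := p₂ + p₃) rfl (by decide) rfl rfl rfl rfl (Y := Y) hY (xb := xb) (pb := pb) hxb hpb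
  simp only [basePoint, slot, ← vec_eq_slotPoint_zero, ← vec_eq_slotPoint_one,
    ← vec_eq_slotPoint_two] at i1 i2 v1 v2 ⊢
  -- The constants of the two sides agree because `(p₁ + p₂) + p₃ = p₁ + (p₂ + p₃)`.
  have hc : ![p₁ + p₂, p₃, x] 0 + ![p₁ + p₂, p₃, x] 1 = ![p₁, p₂ + p₃, x] 0 + ![p₁, p₂ + p₃, x] 1 :=
    add_assoc p₁ p₂ p₃
  rw [hc] at v1
  have e1 := existsUnique_gradMap
    (X_dvd_sideJet (S := S) (slot .first) (basePoint p₁ p₂ p₃ x .first)) 1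
  have e2 := existsUnique_gradMap
    (X_dvd_sideJet (S := S) (slot .second) (basePoint p₁ p₂ p₃ x .second)) 1
  constructor
  · rintro ⟨xb, pb, xt, pt, hxb, hpb, hxt, hpt, h⟩ Y Z hY hZ
    obtain ⟨Y', hY', hxY, hpY⟩ := (i1 xb pb).1 ⟨hxb, hpb⟩
    obtain ⟨Z', hZ', hxZ, hpZ⟩ := (i2 xt pt).1 ⟨hxt, hpt⟩
    rw [v1 Y' hY' xb pb hxY hpY, v2 Z' hZ' xt pt hxZ hpZ, add_right_inj] at h
    rwa [e1.unique hY hY', e2.unique hZ hZ']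
  · intro h
    obtain ⟨Y, hY, -⟩ := e1
    obtain ⟨Z, hZ, -⟩ := e2
    obtain ⟨hxb, hpb⟩ := (i1 _ _).2 ⟨Y, hY, rfl, rfl⟩
    obtain ⟨hxt, hpt⟩ := (i2 _ _).2 ⟨Z, hZ, rfl, rfl⟩
    refine ⟨_, _, _, _, hxb, hpb, hxt, hpt, ?_⟩
    rw [v1 Y hY _ _ rfl rfl, v2 Z hZ _ _ rfl rfl, h Y Z hY hZ]

end Main

end SGA

end

theorem mainTheorem2 (d : ℕ) (S : ℕ → SGA.B₂ d → ℝ)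
    (hS₀ : ∀ p₁ p₂ x : Fin d → ℝ, S 0 ![p₁, p₂, x] = x ⬝ᵥ (p₁ + p₂))
    (hS : ∀ n, 1 ≤ n → ContDiff ℝ ∞ (S n)) :
    SGA.Satisfies S ↔
      ∀ n : ℕ, 0 < n → ∀ p₁ p₂ p₃ x : Fin d → ℝ,
        ∑ k ∈ Finset.Icc 1 n, ∑ t : SGA.BipartiteTree k, (1 / ((k ! : ℕ) : ℝ)) *
          ∑ ν ∈ SGA.compositions k n,
            (SGA.C .first t (fun v => S (ν v)) p₁ p₂ p₃ x -
              SGA.C .second t (fun v => S (ν v)) p₁ p₂ p₃ x) = 0 := by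
  have h0 : S 0 = fun y => y 2 ⬝ᵥ (y 0 + y 1) := by
    funext y
    rw [← hS₀]
    congr 1
    funext s
    fin_cases s <;> rfl
  have hS' : ∀ n, ContDiff ℝ ∞ (S n) := by
    intro n
    rcases n with _ | n
    · rw [h0]
      exact SGA.contDiff_dotProduct
    · exact hS _ (by omega)
  rw [SGA.satisfies_iff h0 hS']
  simp only [Finset.sum_sub_distrib, mul_sub, sub_eq_zero]
  constructor
  · intro h n _ p₁ p₂ p₃ x
    obtain ⟨Y, hY, -⟩ := SGA.existsUnique_gradMap
      (SGA.X_dvd_sideJet (S := S) (SGA.slot .first) (SGA.basePoint p₁ p₂ p₃ x .first)) 1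
    obtain ⟨Z, hZ, -⟩ := SGA.existsUnique_gradMap
      (SGA.X_dvd_sideJet (S := S) (SGA.slot .second) (SGA.basePoint p₁ p₂ p₃ x .second)) 1
    rw [← SGA.coeff_critValue_sideJet hS' .first p₁ p₂ p₃ x hY,
      ← SGA.coeff_critValue_sideJet hS' .second p₁ p₂ p₃ x hZ, h p₁ p₂ p₃ x Y Z hY hZ]
  · intro h p₁ p₂ p₃ x Y Z hY hZ
    ext n
    rw [SGA.coeff_critValue_sideJet hS' .first p₁ p₂ p₃ x hY,
      SGA.coeff_critValue_sideJet hS' .second p₁ p₂ p₃ x hZ]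
    -- The order `h⁰` imposes no condition: no tree has zero vertices.
    rcases n.eq_zero_or_pos with rfl | hn
    · rw [Finset.Icc_eq_empty (by decide), Finset.sum_empty, Finset.sum_empty]
    · exact h n hn p₁ p₂ p₃ x
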